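/- Let $K$ be an algebraically closed field of characteristic $p>0$, let $G$ be a connected reductive algebraic group over $K$, and let $T\subseteq B$ be a maximal torus and a Borel subgroup of $G$. Let $\mathfrak g,\mathfrak b,\mathfrak h$ be the Lie algebras of $G,B,T$, with their $p$-th power maps $x\mapsto x^{[p]}$, let $\mathfrak n^+\subseteq\mathfrak b$ be the sum of the root spaces of the positive roots, that is, of the roots of $(G,T)$ whose root space lies in $\mathfrak b$, and put $$\mathfrak b^\perp=\{\chi\in\mathfrak g^*\mid \chi(\mathfrak b)=0\},\qquad N=\dim_K\mathfrak b^\perp,\qquad \Lambda_0=\{\lambda\in\mathfrak h^*\mid \lambda(h)^p=\lambda(h^{[p]})\text{ for all }h\in\mathfrak h\}$$ (so that $N$ is the number of positive roots). For $\chi\in\mathfrak g^*$ let $$U_\chi(\mathfrak g)=U(\mathfrak g)/\langle x^p-x^{[p]}-\chi(x)^p\mid x\in\mathfrak g\rangle$$ be the reduced enveloping algebra, and define $U_\chi(\mathfrak b)$ in the same way from $\mathfrak b$ and $\chi|_{\mathfrak b}$. For $\lambda\in\Lambda_0$ let $K_\lambda$ be the one-dimensional module over $U_0(\mathfrak b)$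 on which $\mathfrak h$ acts by $\lambda$ and $\mathfrak n^+$ acts by $0$, and for $\chi\in\mathfrak b^\perp$ (so that $U_\chi(\mathfrak b)=U_0(\mathfrak b)$) let $$Z_\chi(\lambda)=U_\chi(\mathfrak g)\otimes_{U_\chi(\mathfrak b)}K_\lambda$$ be the baby Verma module. Let $\lambda\in\Lambda_0$. If there is no $\mu\in\mathfrak b^\perp$ such that $Z_\mu(\lambda)$ is an irreducible $U_\mu(\mathfrak g)$-module, then there is an integer $s$ with $1\le s\le p^N-1$ such that, for every $\chi\in\mathfrak b^\perp$, the module $Z_\chi(\lambda)$ has a $U_\chi(\mathfrak g)$-submodule of dimension $s$ over $K$. -/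

import Mathlib

open Module Topology

attribute [local instance 100] LieRing.ofAssociativeRing

noncomputable section

namespace AlgGrp

variable {K : Type*} [Field K] {n : ℕ}

/-! ### Linear algebraic groups as Zariski closed subgroups of `GL n` -/

/-- The matrix entries of `g`, as a point of affine space of dimension `n * n`. -/
def coords (g : GL (Fin n) K) : Fin n × Fin n → K := fun ij => (g : Matrix (Fin n) (Fin n) K) ij.1 ij.2

/-- The Zariski topology on `GL n K`: the closed sets are the sets of invertible matrices whose
entries satisfy a given system of polynomial equations. -/
@[reducible] def zariski : TopologicalSpace (GL (Fin n) K) :=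
  TopologicalSpace.induced
    (fun g => (MvPolynomial.pointToPoint (k := K) (coords g) :
      PrimeSpectrum (MvPolynomial (Fin n × Fin n) K))) inferInstance

/-- `H` is Zariski closed in `GL n K`. -/
def IsClosedSubgroup (H : Subgroup (GL (Fin n) K)) : Prop :=
  IsClosed[zariski] (H : Set (GL (Fin n) K))

/-- `H` is connected in the Zariski topology. -/
def IsConnectedSubgroup (H : Subgroup (GL (Fin n) K)) : Prop :=
  @IsConnected _ zariski (H : Set (GL (Fin n) K))

/-- Every element of `H` is a unipotent matrix. -/
def IsUnipotentSubgroup (H : Subgroup (GL (Fin n) K)) : Prop :=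
  ∀ u ∈ H, IsNilpotent ((u : Matrix (Fin n) (Fin n) K) - 1)

/-- A torus: a closed connected subgroup that is conjugate in `GL n K` to a group of diagonal
matrices. -/
def IsTorus (H : Subgroup (GL (Fin n) K)) : Prop :=
  IsClosedSubgroup H ∧ IsConnectedSubgroup H ∧
    ∃ P : GL (Fin n) K, ∀ t ∈ H, ((P * t * P⁻¹ : GL (Fin n) K) : Matrix (Fin n) (Fin n) K).IsDiag

/-- `T` is a maximal torus of `G`. -/
def IsMaximalTorus (G T : Subgroup (GL (Fin n) K)) : Prop :=
  Maximal (fun H => H ≤ G ∧ IsTorus H) T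

/-- `B` is a Borel subgroup of `G`: a maximal closed connected solvable subgroup. -/
def IsBorel (G B : Subgroup (GL (Fin n) K)) : Prop :=
  Maximal (fun H => H ≤ G ∧ IsClosedSubgroup H ∧ IsConnectedSubgroup H ∧ Group.IsSolvable H) B

/-- `G` is a connected reductive algebraic group: it is closed and connected, and its only closed
connected normal unipotent subgroup is the trivial one. -/
def IsConnectedReductive (G : Subgroup (GL (Fin n) K)) : Prop :=
  IsClosedSubgroup G ∧ IsConnectedSubgroup G ∧
    ∀ H : Subgroup (GL (Fin n) K), H ≤ G → IsClosedSubgroup H → IsConnectedSubgroup H →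
      (∀ g ∈ G, ∀ h ∈ H, g * h * g⁻¹ ∈ H) → IsUnipotentSubgroup H → H = ⊥

/-! ### The Lie algebra of a linear algebraic group and its `p`-th power map -/

/-- The ideal of polynomials in the matrix entries that vanish on `H`. -/
def ideal (H : Subgroup (GL (Fin n) K)) : Ideal (MvPolynomial (Fin n × Fin n) K) :=
  MvPolynomial.vanishingIdeal K (coords '' (H : Set (GL (Fin n) K)))

/-- The left invariant vector field of `X ∈ 𝔤𝔩 n` as a derivation of the coordinate ring of the
space of matrices `(x i j)`. It sends `x i j` to the `(i, j)` entry of the matrix `x * X`, so that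
`(invDer X f) (g)` is the derivative of `f (g * (1 + t X))` at `t = 0`. -/
def invDer (X : Matrix (Fin n) (Fin n) K) :
    Derivation K (MvPolynomial (Fin n × Fin n) K) (MvPolynomial (Fin n × Fin n) K) :=
  MvPolynomial.mkDerivation K
    (fun ij => ∑ k, MvPolynomial.C (X k ij.2) * MvPolynomial.X (ij.1, k))

lemma invDer_X (X : Matrix (Fin n) (Fin n) K) (i j : Fin n) :
    invDer X (MvPolynomial.X (i, j)) = ∑ k, MvPolynomial.C (X k j) * MvPolynomial.X (i, k) := by
  simp [invDer]

lemma invDer_invDer_X (X Y : Matrix (Fin n) (Fin n) K) (i j : Fin n) :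
    invDer X (invDer Y (MvPolynomial.X (i, j))) = invDer (X * Y) (MvPolynomial.X (i, j)) := by
  simp only [invDer_X, map_sum, Derivation.leibniz, MvPolynomial.derivation_C,
    smul_eq_mul, Matrix.mul_apply, Finset.mul_sum, Finset.sum_mul, map_mul]
  simp only [mul_zero, add_zero]
  rw [Finset.sum_comm]
  refine Finset.sum_congr rfl fun k _ => Finset.sum_congr rfl fun l _ => ?_
  ring

lemma invDer_add (X Y : Matrix (Fin n) (Fin n) K) : invDer (X + Y) = invDer X + invDer Y := by
  refine MvPolynomial.derivation_ext fun ⟨i, j⟩ => ?_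
  simp [invDer_X, add_mul, Finset.sum_add_distrib]

lemma invDer_smul (c : K) (X : Matrix (Fin n) (Fin n) K) : invDer (c • X) = c • invDer X := by
  refine MvPolynomial.derivation_ext fun ⟨i, j⟩ => ?_
  simp [invDer_X, Finset.smul_sum, MvPolynomial.smul_eq_C_mul, mul_assoc]

lemma invDer_zero : invDer (0 : Matrix (Fin n) (Fin n) K) = 0 := by
  refine MvPolynomial.derivation_ext fun ⟨i, j⟩ => ?_
  simp [invDer_X]

lemma invDer_lie (X Y : Matrix (Fin n) (Fin n) K) : invDer ⁅X, Y⁆ = ⁅invDer X, invDer Y⁆ := by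
  refine MvPolynomial.derivation_ext fun ⟨i, j⟩ => ?_
  rw [Derivation.commutator_apply, invDer_invDer_X, invDer_invDer_X, Ring.lie_def]
  simp [invDer_X, sub_mul, Finset.sum_sub_distrib]

/-- The Lie algebra of the algebraic group `H`: the matrices whose left invariant vector fields are
tangent to `H`. -/
def lieAlg (H : Subgroup (GL (Fin n) K)) : LieSubalgebra K (Matrix (Fin n) (Fin n) K) where
  carrier := {X | ∀ f ∈ ideal H, invDer X f ∈ ideal H}
  add_mem' {X Y} hX hY f hf := by
    rw [invDer_add]
    exact (ideal H).add_mem (hX f hf) (hY f hf)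
  zero_mem' f _ := by
    rw [invDer_zero]
    exact (ideal H).zero_mem
  smul_mem' c X hX f hf := by
    rw [invDer_smul, Derivation.smul_apply, MvPolynomial.smul_eq_C_mul]
    exact (ideal H).mul_mem_left _ (hX f hf)
  lie_mem' {X Y} hX hY f hf := by
    rw [invDer_lie, Derivation.commutator_apply]
    exact (ideal H).sub_mem (hX _ (hY f hf)) (hY _ (hX f hf))

/-- In characteristic `p`, the `p`-th power of a derivation is a derivation. -/
lemma derivation_pow_char (p : ℕ) [Fact p.Prime] [CharP K p] {A : Type*} [CommRing A] [Algebra K A]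
    (D : Derivation K A A) (a b : A) :
    ((D : A →ₗ[K] A) ^ p) (a * b) =
      ((D : A →ₗ[K] A) ^ p) a * b + a * ((D : A →ₗ[K] A) ^ p) b := by
  have key : ∀ m : ℕ, ((D : A →ₗ[K] A) ^ m) (a * b) = ∑ ij ∈ Finset.HasAntidiagonal.antidiagonal m,
      m.choose ij.1 • (((D : A →ₗ[K] A) ^ ij.1) a * ((D : A →ₗ[K] A) ^ ij.2) b) := by
    intro m
    induction m with
    | zero => simp
    | succ m ih =>
      rw [pow_succ', Module.End.mul_apply, ih, map_sum,
        Finset.sum_antidiagonal_choose_succ_nsmul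
          (fun i j => ((D : A →ₗ[K] A) ^ i) a * ((D : A →ₗ[K] A) ^ j) b) m,
        ← Finset.sum_add_distrib]
      refine Finset.sum_congr rfl fun ij hij => ?_
      rw [map_nsmul, pow_succ', pow_succ', Module.End.mul_apply, Module.End.mul_apply]
      have hs : m.choose ij.2 = m.choose ij.1 := by
        rw [← Finset.HasAntidiagonal.mem_antidiagonal.mp hij, Nat.choose_symm_add]
      rw [hs, ← nsmul_add]
      congr 1
      simp only [Derivation.coeFn_coe, Derivation.leibniz, smul_eq_mul]
      ring
  have hp := (Fact.out : p.Prime)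
  have hcast : ∀ k : ℕ, p ∣ k → ∀ x : A, k • x = 0 := by
    rintro k hk x
    rw [← Nat.cast_smul_eq_nsmul K, (CharP.cast_eq_zero_iff K p k).mpr hk, zero_smul]
  rw [key p, Finset.Nat.sum_antidiagonal_eq_sum_range_succ_mk, Finset.sum_range_succ,
    ← Nat.succ_pred_eq_of_pos hp.pos, Finset.sum_range_succ', Finset.sum_eq_zero]
  · simp [add_comm]
  · intro i hi
    refine hcast _ ?_ _
    rw [Nat.succ_pred_eq_of_pos hp.pos]
    have := Finset.mem_range.mp hi
    refine hp.dvd_choose_self (by omega) ?_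
    have := Nat.succ_pred_eq_of_pos hp.pos
    omega

lemma invDer_pow_char (p : ℕ) [Fact p.Prime] [CharP K p] (X : Matrix (Fin n) (Fin n) K)
    (f : MvPolynomial (Fin n × Fin n) K) :
    invDer (X ^ p) f = ((↑(invDer X) : Module.End K (MvPolynomial (Fin n × Fin n) K)) ^ p) f := by
  let E : Derivation K (MvPolynomial (Fin n × Fin n) K) (MvPolynomial (Fin n × Fin n) K) :=
    Derivation.mk' ((↑(invDer X) : Module.End K (MvPolynomial (Fin n × Fin n) K)) ^ p) fun a b => by
      rw [derivation_pow_char]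
      simp only [smul_eq_mul]
      ring
  have hpow : ∀ (m : ℕ) (i j : Fin n), ((↑(invDer X) : Module.End K (MvPolynomial (Fin n × Fin n) K)) ^ (m + 1)) (MvPolynomial.X (i, j)) =
      invDer (X ^ (m + 1)) (MvPolynomial.X (i, j)) := by
    intro m i j
    induction m with
    | zero => simp
    | succ m ih =>
      rw [pow_succ', Module.End.mul_apply, ih, Derivation.coeFn_coe, invDer_invDer_X, ← pow_succ']
  have hE : invDer (X ^ p) = E := by
    refine MvPolynomial.derivation_ext fun ⟨i, j⟩ => ?_
    have h := hpow (p - 1) i j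
    rw [Nat.sub_add_cancel (Fact.out : p.Prime).one_le] at h
    exact h.symm
  rw [hE]
  rfl

/-- The `p`-th power map `x ↦ x^[p]` of the restricted Lie algebra `lieAlg H`. As `H` is a group of
matrices it is the `p`-th power of matrices. -/
def pMap (p : ℕ) [Fact p.Prime] [CharP K p] (H : Subgroup (GL (Fin n) K)) (x : lieAlg H) :
    lieAlg H :=
  ⟨(x : Matrix (Fin n) (Fin n) K) ^ p, fun f hf => by
    rw [invDer_pow_char]
    suffices h : ∀ m : ℕ,
        ((↑(invDer (x : Matrix (Fin n) (Fin n) K)) :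
          Module.End K (MvPolynomial (Fin n × Fin n) K)) ^ m) f ∈ ideal H from h p
    intro m
    induction m with
    | zero => simpa using hf
    | succ m ih =>
      rw [pow_succ', Module.End.mul_apply]
      exact x.2 _ ih⟩

/-! ### Roots and the nilradical of the Borel subalgebra -/

/-- The weight space of `T` of weight `α` in the Lie algebra of `G`, under the adjoint action. -/
def weightSpace (G T : Subgroup (GL (Fin n) K)) (α : T →* Kˣ) :
    Submodule K (Matrix (Fin n) (Fin n) K) where
  carrier := {X | X ∈ lieAlg G ∧ ∀ t : T,
    ((t : GL (Fin n) K) : Matrix (Fin n) (Fin n) K) * X *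
      (((t : GL (Fin n) K)⁻¹ : GL (Fin n) K) : Matrix (Fin n) (Fin n) K) = (α t : K) • X}
  add_mem' {X Y} hX hY := ⟨add_mem hX.1 hY.1, fun t => by
    rw [mul_add, add_mul, hX.2 t, hY.2 t, smul_add]⟩
  zero_mem' := ⟨zero_mem _, fun t => by simp⟩
  smul_mem' c X hX := ⟨(lieAlg G).smul_mem c hX.1, fun t => by
    rw [mul_smul_comm, smul_mul_assoc, hX.2 t, smul_comm]⟩

/-- The roots of `G` with respect to `T`: the nontrivial weights of `T` in the Lie algebra of `G`. -/
def roots (G T : Subgroup (GL (Fin n) K)) : Set (T →* Kˣ) :=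
  {α | α ≠ 1 ∧ weightSpace G T α ≠ ⊥}

/-- The positive roots that correspond to `B`: those whose root space lies in `Lie B`. -/
def posRoots (G T B : Subgroup (GL (Fin n) K)) : Set (T →* Kˣ) :=
  {α | α ∈ roots G T ∧ weightSpace G T α ≤ (lieAlg B).toSubmodule}

/-- `𝔫⁺`, the sum of the root spaces of the positive roots. -/
def nPos (G T B : Subgroup (GL (Fin n) K)) : Submodule K (Matrix (Fin n) (Fin n) K) :=
  ⨆ α ∈ posRoots G T B, weightSpace G T α

/-! ### Weights -/

/-- `Λ₀`: the linear forms `lam` on `𝔥 = Lie T` with `lam(h)^p - lam(h^[p]) = 0` for all `h`. -/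
def Lambda0 (p : ℕ) [Fact p.Prime] [CharP K p] (T : Subgroup (GL (Fin n) K)) :
    Set (Dual K (lieAlg T)) :=
  {lam | ∀ h : lieAlg T, lam h ^ p - lam (pMap p T h) = 0}

/-- The one-dimensional module `K_lam` over the reduced enveloping algebra `U_0(𝔟)`, where
`𝔟 = Lie B`, on which `𝔫⁺` acts by zero and `𝔥` acts by `lam`. It is given by the scalars `act x`
by which the elements `x` of `𝔟` act. -/
structure WeightModule (p : ℕ) [Fact p.Prime] [CharP K p] (G T B : Subgroup (GL (Fin n) K))
    (lam : Dual K (lieAlg T)) where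
  /-- the action of `𝔟` on the line -/
  act : lieAlg B →ₗ⁅K⁆ K
  /-- the line is a module over `U_0(𝔟)`, that is, `x ^ p - x^[p]` acts by zero -/
  act_pMap : ∀ x : lieAlg B, act x ^ p - act (pMap p B x) = 0
  /-- `𝔥` acts by `lam` -/
  act_torus : ∀ (x : lieAlg B) (hx : (x : Matrix (Fin n) (Fin n) K) ∈ lieAlg T),
    act x = lam ⟨x, hx⟩
  /-- `𝔫⁺` acts by zero -/
  act_nPos : ∀ x : lieAlg B, (x : Matrix (Fin n) (Fin n) K) ∈ nPos G T B → act x = 0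

/-- `𝔟^⊥`: the linear forms on `𝔤 = Lie G` that vanish on `𝔟 = Lie B`. -/
def borelPerp (G B : Subgroup (GL (Fin n) K)) : Submodule K (Dual K (lieAlg G)) where
  carrier := {χ | ∀ x : lieAlg G, (x : Matrix (Fin n) (Fin n) K) ∈ lieAlg B → χ x = 0}
  add_mem' {χ μ} hχ hμ x hx := by
    rw [LinearMap.add_apply, hχ x hx, hμ x hx, add_zero]
  zero_mem' _ _ := rfl
  smul_mem' c χ hχ x hx := by
    rw [LinearMap.smul_apply, hχ x hx, smul_zero]

/-! ### Reduced enveloping algebras and baby Verma modules -/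

/-- The relations of the reduced enveloping algebra `U_χ(𝔤)`:
`x ^ p - x^[p] - χ(x) ^ p = 0` for all `x ∈ 𝔤`. -/
inductive ReducedRel (p : ℕ) [Fact p.Prime] [CharP K p] (G : Subgroup (GL (Fin n) K))
    (χ : Dual K (lieAlg G)) :
    UniversalEnvelopingAlgebra K (lieAlg G) → UniversalEnvelopingAlgebra K (lieAlg G) → Prop
  | of (x : lieAlg G) : ReducedRel p G χ
      (UniversalEnvelopingAlgebra.ι K x ^ p - UniversalEnvelopingAlgebra.ι K (pMap p G x)
        - algebraMap K _ (χ x ^ p)) 0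

/-- The reduced enveloping algebra `U_χ(𝔤)`: the quotient of `U(𝔤)` by the two-sided ideal
generated by the elements `x ^ p - x^[p] - χ(x) ^ p`. -/
abbrev ReducedEnveloping (p : ℕ) [Fact p.Prime] [CharP K p] (G : Subgroup (GL (Fin n) K))
    (χ : Dual K (lieAlg G)) : Type _ :=
  RingQuot (ReducedRel p G χ)

/-- The canonical map `𝔤 → U_χ(𝔤)`. -/
def toReduced (p : ℕ) [Fact p.Prime] [CharP K p] (G : Subgroup (GL (Fin n) K))
    (χ : Dual K (lieAlg G)) (x : lieAlg G) : ReducedEnveloping p G χ :=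
  RingQuot.mkAlgHom K (ReducedRel p G χ) (UniversalEnvelopingAlgebra.ι K x)

/-- The left ideal of `U_χ(𝔤)` generated by the elements `x - act x` with `x ∈ 𝔟`, where `act`
is the action of `𝔟` on `K_lam`. -/
def vermaIdeal (p : ℕ) [Fact p.Prime] [CharP K p] (G : Subgroup (GL (Fin n) K))
    {T B : Subgroup (GL (Fin n) K)} {lam : Dual K (lieAlg T)} (Klam : WeightModule p G T B lam)
    (χ : Dual K (lieAlg G)) :
    Submodule (ReducedEnveloping p G χ) (ReducedEnveloping p G χ) :=
  Submodule.span (ReducedEnveloping p G χ)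
    {u | ∃ (x : lieAlg G) (hx : (x : Matrix (Fin n) (Fin n) K) ∈ lieAlg B),
      u = toReduced p G χ x - algebraMap K _ (Klam.act ⟨x, hx⟩)}

/-- The baby Verma module `Z_χ(lam) = U_χ(𝔤) ⊗_{U_χ(𝔟)} K_lam` for `χ ∈ 𝔟^⊥`. As `K_lam` is the
quotient of `U_χ(𝔟) = U_0(𝔟)` by the left ideal generated by the elements `x - act x`, the tensor
product is the quotient of `U_χ(𝔤)` by the left ideal that these elements generate. -/
abbrev BabyVerma (p : ℕ) [Fact p.Prime] [CharP K p] (G : Subgroup (GL (Fin n) K))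
    {T B : Subgroup (GL (Fin n) K)} {lam : Dual K (lieAlg T)} (Klam : WeightModule p G T B lam)
    (χ : Dual K (lieAlg G)) : Type _ :=
  ReducedEnveloping p G χ ⧸ vermaIdeal p G Klam χ

end AlgGrp

end

/-!
The proof uses of `G` and `B` only that `Lie G` and `Lie G ∩ Lie B` are Lie algebras of matrices
that are closed under `p`-th powers, and of the module `K_lam` only that it is a one-dimensional
restricted module.

**A common vector space.** Let `y i` be vectors that complement `𝔟` in `𝔤`, with `N` of them. The
elements `x ^ p - x^[p]` of `U(𝔤)` are central and depend `p`-semilinearly on `x`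
(`pCentral_mem_center`, `pCentral_sum`; both come from identities for `ad(a) ^ (p - 1)` in
characteristic `p`, the semilinearity through Jacobson's formula `add_pow_char_eq`). By the
Poincaré–Birkhoff–Witt theorem `U(𝔤)` is therefore a free right module over
`K[ξ] ⊗ U(𝔟)`, where `ξ i` acts as `y i ^ p - (y i)^[p]`, with basis the `p ^ N` monomials in the
`y i` with exponents less than `p` (`freeMap_bijective`). Letting `U(𝔟)` act by `K_lam` and `ξ i` by
`τ i = χ (y i) ^ p` identifies every `Z_χ(lam)` with the same space `K ^ (p ^ N)`
(`babyVermaEquiv`). The elements of `𝔤` act on it by matrices whose entries are polynomials in `τ`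
(`actionMatrix`), and as `χ` varies `τ` takes all values, since `K` is algebraically closed
(`exists_centralValue_eq`).

The independence half of the Poincaré–Birkhoff–Witt theorem is proved for Lie algebras of matrices
(`exists_symbol`). A matrix `X` acts on functions on the space of matrices by a vector field, and
it also defines a linear function on this space; the operators `vectorField X + T * linearFunction X` form a
representation over the polynomials in a formal variable `T`. Applied to the constant function
`1`, a product of `k` elements has a leading coefficient at `T ^ k` that is the product of their
linear functions. This separates the leading terms of the elements of the enveloping algebra.

**A common dimension.** For a family of matrices that depends polynomially on `τ`, the set of `τ`
for which there is a stable subspace of dimension `r` is closed: it is the image of a closed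
subset of the product of a Grassmannian and the space of all `τ`, and Grassmannians are
projective. This is made explicit with Plücker coordinates (`IsStablePluecker`) and elimination
theory (`exists_resultant`). If no `Z_χ(lam)` is irreducible, the closed sets for
`1 ≤ r ≤ p ^ N - 1` cover the affine space of all `τ`. As it is irreducible, one of them is the whole
space (`exists_dimension_forall_stable`), and its `r` is the required `s`.
-/

noncomputable section

namespace FaithfulPBW

/-! ### A representation by differential operators on the space of matrices -/

section Operators

variable {K R m : Type*} [Field K] [CommRing R] [Algebra K R] [Fintype m]

/-- The left invariant vector field of the matrix `X` on the space of matrices `(x i j)`, with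
coefficients in `R`. -/
def vectorField (R : Type*) [CommRing R] [Algebra K R] (X : Matrix m m K) :
    Derivation R (MvPolynomial (m × m) R) (MvPolynomial (m × m) R) :=
  MvPolynomial.mkDerivation R
    (fun ij => ∑ k, MvPolynomial.C (algebraMap K R (X k ij.2)) * MvPolynomial.X (ij.1, k))

lemma vectorField_X (X : Matrix m m K) (i j : m) :
    vectorField R X (MvPolynomial.X (i, j)) =
      ∑ k, MvPolynomial.C (algebraMap K R (X k j)) * MvPolynomial.X (i, k) := by
  simp [vectorField]

lemma vectorField_vectorField_X (X Y : Matrix m m K) (i j : m) :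
    vectorField R X (vectorField R Y (MvPolynomial.X (i, j))) =
      vectorField R (X * Y) (MvPolynomial.X (i, j)) := by
  simp only [vectorField_X, map_sum, Derivation.leibniz, MvPolynomial.derivation_C,
    smul_eq_mul, Matrix.mul_apply, Finset.mul_sum, Finset.sum_mul, map_mul]
  simp only [mul_zero, add_zero]
  rw [Finset.sum_comm]
  refine Finset.sum_congr rfl fun k _ => Finset.sum_congr rfl fun l _ => ?_
  ring

lemma vectorField_add (X Y : Matrix m m K) :
    vectorField R (X + Y) = vectorField R X + vectorField R Y := by
  refine MvPolynomial.derivation_ext fun ⟨i, j⟩ => ?_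
  simp [vectorField_X, add_mul, Finset.sum_add_distrib]

lemma vectorField_smul (c : K) (X : Matrix m m K) :
    vectorField R (c • X) = algebraMap K R c • vectorField R X := by
  refine MvPolynomial.derivation_ext fun ⟨i, j⟩ => ?_
  simp only [vectorField_X, Matrix.smul_apply, smul_eq_mul, map_mul, Derivation.smul_apply,
    MvPolynomial.smul_eq_C_mul, Finset.mul_sum, mul_assoc]

lemma vectorField_commutator [DecidableEq m] (X Y : Matrix m m K) (f : MvPolynomial (m × m) R) :
    vectorField R (X * Y - Y * X) f =
      vectorField R X (vectorField R Y f) - vectorField R Y (vectorField R X f) := by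
  have h : vectorField R (X * Y - Y * X) = ⁅vectorField R X, vectorField R Y⁆ := by
    refine MvPolynomial.derivation_ext fun ⟨i, j⟩ => ?_
    rw [Derivation.commutator_apply, vectorField_vectorField_X, vectorField_vectorField_X]
    simp [vectorField_X, sub_mul, Finset.sum_sub_distrib]
  rw [h, Derivation.commutator_apply]

/-- The function `∑ z i j * (x * X) i j` on the space of matrices `(x i j)`. -/
def linearFunction (z : m → m → R) (X : Matrix m m K) : MvPolynomial (m × m) R :=
  ∑ i, ∑ j, MvPolynomial.C (z i j) * vectorField R X (MvPolynomial.X (i, j))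

lemma linearFunction_add (z : m → m → R) (X Y : Matrix m m K) :
    linearFunction z (X + Y) = linearFunction z X + linearFunction z Y := by
  simp [linearFunction, vectorField_add, mul_add, Finset.sum_add_distrib]

lemma linearFunction_smul (z : m → m → R) (c : K) (X : Matrix m m K) :
    linearFunction z (c • X) = c • linearFunction z X := by
  simp only [linearFunction, vectorField_smul, Finset.smul_sum, Derivation.smul_apply,
    algebraMap_smul, mul_smul_comm]

lemma vectorField_linearFunction (z : m → m → R) (X Y : Matrix m m K) :
    vectorField R X (linearFunction z Y) = linearFunction z (X * Y) := by
  simp [linearFunction, vectorField_vectorField_X]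

lemma linearFunction_sub (z : m → m → R) (X Y : Matrix m m K) :
    linearFunction z (X - Y) = linearFunction z X - linearFunction z Y := by
  rw [eq_sub_iff_add_eq, ← linearFunction_add, sub_add_cancel]

/-- The value of `linearFunction z X` at the identity matrix. -/
lemma eval_linearFunction [DecidableEq m] (z : m → m → R) (X : Matrix m m K) :
    MvPolynomial.eval (fun ij : m × m => (1 : Matrix m m R) ij.1 ij.2) (linearFunction z X) =
      ∑ i, ∑ j, X i j • z i j := by
  simp [linearFunction, vectorField_X, Matrix.one_apply, Algebra.smul_def, mul_comm]

/-- Sequences of functions on the space of matrices, thought of as the coefficients of a power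
series in a formal variable `T`. -/
abbrev Symbols (m R : Type*) [CommRing R] := ℕ → MvPolynomial (m × m) R

/-- The operator `vectorField X + T * linearFunction z X` on power series in `T`. -/
def symbolOperator (z : m → m → R) (X : Matrix m m K) : Module.End K (Symbols m R) where
  toFun f k := vectorField R X (f k) +
    (match k with
      | 0 => 0
      | k + 1 => linearFunction z X * f k)
  map_add' f g := by
    funext k
    cases k with
    | zero => simp
    | succ k => simp only [Pi.add_apply, map_add]; ring
  map_smul' c f := by
    funext k
    have h : vectorField R X (c • f k) = c • vectorField R X (f k) := by
      rw [← algebraMap_smul R c, Derivation.map_smul, algebraMap_smul]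
    cases k with
    | zero => simp [h]
    | succ k => simp [h]

lemma symbolOperator_zero (z : m → m → R) (X : Matrix m m K) (f : Symbols m R) :
    symbolOperator z X f 0 = vectorField R X (f 0) := by
  simp [symbolOperator]

lemma symbolOperator_succ (z : m → m → R) (X : Matrix m m K) (f : Symbols m R) (k : ℕ) :
    symbolOperator z X f (k + 1) = vectorField R X (f (k + 1)) + linearFunction z X * f k := rfl

/-- The operators `vectorField X + T * linearFunction z X` form a representation of the Lie algebra
of all matrices. -/
def symbolHom [DecidableEq m] (z : m → m → R) : Matrix m m K →ₗ⁅K⁆ Module.End K (Symbols m R) where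
  toFun := symbolOperator z
  map_add' X Y := by
    ext f k : 2
    cases k with
    | zero => simp [symbolOperator_zero, vectorField_add]
    | succ k =>
      simp only [symbolOperator_succ, vectorField_add, linearFunction_add, LinearMap.add_apply,
        Pi.add_apply, Derivation.add_apply]
      ring
  map_smul' c X := by
    ext f k : 2
    cases k with
    | zero => simp [symbolOperator_zero, vectorField_smul]
    | succ k =>
      simp [symbolOperator_succ, vectorField_smul, linearFunction_smul]
  map_lie' {X Y} := by
    ext f k : 2
    rw [Ring.lie_def (symbolOperator z X)]
    simp only [LinearMap.sub_apply, Module.End.mul_apply, Pi.sub_apply]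
    rcases k with _ | _ | k
    · simp [symbolOperator_zero, Ring.lie_def, vectorField_commutator]
    · simp only [symbolOperator_succ, symbolOperator_zero, Ring.lie_def, vectorField_commutator,
        linearFunction_sub, map_add, Derivation.leibniz,
        vectorField_linearFunction, smul_eq_mul]
      ring
    · simp only [symbolOperator_succ, Ring.lie_def, vectorField_commutator,
        linearFunction_sub, map_add, Derivation.leibniz,
        vectorField_linearFunction, smul_eq_mul]
      ring

end Operators

/-! ### The degree filtration of the enveloping algebra and symbols -/

section Filtration

variable (K L : Type*) [Field K] [LieRing L] [LieAlgebra K L]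

/-- The elements of degree at most one of the enveloping algebra. -/
def degreeLEOne : Submodule K (UniversalEnvelopingAlgebra K L) :=
  1 ⊔ LinearMap.range (UniversalEnvelopingAlgebra.ι K : L →ₗ⁅K⁆ _).toLinearMap

/-- The elements of the enveloping algebra that are sums of products of at most `k` elements of the
Lie algebra. -/
def degreeLE (k : ℕ) : Submodule K (UniversalEnvelopingAlgebra K L) := degreeLEOne K L ^ k

/-- The elements of the enveloping algebra that are sums of products of fewer than `k` elements of
the Lie algebra. -/
def degreeLT : ℕ → Submodule K (UniversalEnvelopingAlgebra K L)
  | 0 => ⊥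
  | k + 1 => degreeLE K L k

variable {K L}

local notation "U" => UniversalEnvelopingAlgebra K L

lemma mem_degreeLEOne {u : U} : u ∈ degreeLEOne K L ↔
    ∃ (r : K) (x : L), u = algebraMap K U r + UniversalEnvelopingAlgebra.ι K x := by
  simp only [degreeLEOne, Submodule.mem_sup, Submodule.mem_one, LinearMap.mem_range]
  constructor
  · rintro ⟨_, ⟨r, rfl⟩, _, ⟨x, rfl⟩, rfl⟩
    exact ⟨r, x, rfl⟩
  · rintro ⟨r, x, rfl⟩
    exact ⟨_, ⟨r, rfl⟩, _, ⟨x, rfl⟩, rfl⟩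

lemma ι_mem_degreeLE (x : L) : UniversalEnvelopingAlgebra.ι K x ∈ degreeLE K L 1 := by
  rw [degreeLE, pow_one, mem_degreeLEOne]
  exact ⟨0, x, by simp⟩

lemma one_le_degreeLEOne : 1 ≤ degreeLEOne K L := le_sup_left

lemma one_mem_degreeLE (k : ℕ) : (1 : U) ∈ degreeLE K L k :=
  Submodule.one_le.mp (one_le_pow_of_one_le' (one_le_degreeLEOne (K := K) (L := L)) k)

lemma degreeLE_mono : Monotone (degreeLE K L) :=
  pow_right_monotone (one_le_degreeLEOne (K := K) (L := L))

lemma mul_mem_degreeLE {k l : ℕ} {u w : U} (hu : u ∈ degreeLE K L k) (hw : w ∈ degreeLE K L l) :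
    u * w ∈ degreeLE K L (k + l) := by
  rw [degreeLE, pow_add]
  exact Submodule.mul_mem_mul hu hw

lemma pow_mem_degreeLE {k : ℕ} {u : U} (hu : u ∈ degreeLE K L k) (l : ℕ) :
    u ^ l ∈ degreeLE K L (l * k) := by
  rw [degreeLE, mul_comm, pow_mul]
  exact Submodule.pow_mem_pow _ hu l

lemma mul_mem_degreeLT {k l : ℕ} {u w : U} (hu : u ∈ degreeLE K L k) (hw : w ∈ degreeLT K L l) :
    u * w ∈ degreeLT K L (k + l) := by
  cases l with
  | zero =>
    rw [degreeLT, Submodule.mem_bot] at hw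
    simp [hw]
  | succ l =>
    exact mul_mem_degreeLE hu hw

lemma adjoin_range_ι : Algebra.adjoin K (Set.range (UniversalEnvelopingAlgebra.ι K : L → U)) = ⊤ := by
  set S := Algebra.adjoin K (Set.range (UniversalEnvelopingAlgebra.ι K : L → U)) with hS
  have hmem : ∀ x : L, UniversalEnvelopingAlgebra.ι K x ∈ S := fun x =>
    Algebra.subset_adjoin ⟨x, rfl⟩
  let f : L →ₗ⁅K⁆ S :=
    { toFun := fun x => ⟨UniversalEnvelopingAlgebra.ι K x, hmem x⟩
      map_add' := fun x y => Subtype.ext (map_add _ x y)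
      map_smul' := fun c x => Subtype.ext (map_smul _ c x)
      map_lie' := fun {x y} => Subtype.ext (LieHom.map_lie _ x y) }
  have h : S.val.comp (UniversalEnvelopingAlgebra.lift K f) = AlgHom.id K U := by
    ext x
    simp only [LieHom.coe_comp, AlgHom.coe_toLieHom, Function.comp_apply, AlgHom.coe_comp,
      UniversalEnvelopingAlgebra.lift_ι_apply]
    rfl
  refine eq_top_iff.mpr fun u _ => ?_
  have := congrArg (fun g : U →ₐ[K] U => g u) h
  simp only [AlgHom.coe_comp, Function.comp_apply, AlgHom.id_apply] at this
  rw [← this]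
  exact (UniversalEnvelopingAlgebra.lift K f u).2

lemma exists_mem_degreeLE (u : U) : ∃ k, u ∈ degreeLE K L k := by
  have hu : u ∈ Algebra.adjoin K (Set.range (UniversalEnvelopingAlgebra.ι K : L → U)) := by
    rw [adjoin_range_ι]; trivial
  induction hu using Algebra.adjoin_induction with
  | mem x hx =>
    obtain ⟨x, rfl⟩ := hx
    exact ⟨1, ι_mem_degreeLE x⟩
  | algebraMap r => exact ⟨0, by
      rw [Algebra.algebraMap_eq_smul_one]
      exact Submodule.smul_mem _ _ (one_mem_degreeLE 0)⟩
  | add x y _ _ hx hy =>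
    obtain ⟨k, hk⟩ := hx
    obtain ⟨l, hl⟩ := hy
    exact ⟨max k l, add_mem (degreeLE_mono (le_max_left _ _) hk)
      (degreeLE_mono (le_max_right _ _) hl)⟩
  | mul x y _ _ hx hy =>
    obtain ⟨k, hk⟩ := hx
    obtain ⟨l, hl⟩ := hy
    exact ⟨k + l, mul_mem_degreeLE hk hl⟩

/-- For a Lie algebra of matrices the leading terms of elements of the enveloping algebra can be
read off as polynomials: the enveloping algebra acts by the operators
`vectorField X + T * linearFunction z X`, and the coefficient of `T ^ k` in the action of a product
of `k` elements on `1` is, at the identity matrix, the product of their linear functions. -/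
theorem exists_symbol {m ι : Type*} [Fintype m] [DecidableEq m] (ρ : L →ₗ⁅K⁆ Matrix m m K)
    (hρ : Function.Injective ρ) (v : Basis ι K L) :
    ∃ s : ℕ → U →ₗ[K] MvPolynomial ι K,
      s 0 1 = 1 ∧ (∀ k, ∀ u ∈ degreeLT K L k, s k u = 0) ∧
      (∀ k l, ∀ u ∈ degreeLE K L k, ∀ w ∈ degreeLE K L l, s (k + l) (u * w) = s k u * s l w) ∧
      ∀ i, s 1 (UniversalEnvelopingAlgebra.ι K (v i)) = MvPolynomial.X i := by
  obtain ⟨ψ, hψ⟩ := LinearMap.exists_leftInverse_of_injective (ρ : L →ₗ[K] Matrix m m K)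
    (LinearMap.ker_eq_bot.mpr hρ)
  -- `lin` is the inclusion of the Lie algebra in its symmetric algebra. The coefficients `z` are
  -- chosen such that the linear function of `ρ x` takes the value `lin x` at the identity matrix.
  let lin : L →ₗ[K] MvPolynomial ι K := v.constr K MvPolynomial.X
  let z : m → m → MvPolynomial ι K := fun i j => lin (ψ (Matrix.single i j 1))
  have hz : ∀ X : Matrix m m K, ∑ i, ∑ j, X i j • z i j = lin (ψ X) := by
    intro X
    conv_rhs => rw [Matrix.matrix_eq_sum_single X]
    simp only [map_sum, z, ← map_smul, Matrix.smul_single, smul_eq_mul, mul_one]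
  let Θ := UniversalEnvelopingAlgebra.lift K ((symbolHom z).comp ρ)
  have hΘ : ∀ x f, Θ (UniversalEnvelopingAlgebra.ι K x) f = symbolOperator z (ρ x) f := by
    intro x f
    simp only [Θ, UniversalEnvelopingAlgebra.lift_ι_apply]
    rfl
  let e : Symbols m (MvPolynomial ι K) := Pi.single 0 1
  have he : ∀ j, 0 < j → e j = 0 := fun j hj => Pi.single_eq_of_ne hj.ne' _
  -- an element of degree at most `k` raises the degree in `T` by at most `k`, and on coefficients
  -- of the top degree it is multiplication by a function that does not depend on `f`
  have key : ∀ (k : ℕ) (u : U), u ∈ degreeLE K L k → ∀ (l : ℕ) (f : Symbols m (MvPolynomial ι K)),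
      (∀ j, l < j → f j = 0) →
      (∀ j, k + l < j → Θ u f j = 0) ∧ Θ u f (k + l) = Θ u e k * f l := by
    intro k u hu
    refine Submodule.pow_induction_on_left' (degreeLEOne K L)
      (C := fun k u _ => ∀ (l : ℕ) (f : Symbols m (MvPolynomial ι K)),
        (∀ j, l < j → f j = 0) →
        (∀ j, k + l < j → Θ u f j = 0) ∧ Θ u f (k + l) = Θ u e k * f l) ?_ ?_ ?_ hu
    · intro r l f hf
      refine ⟨fun j hj => ?_, ?_⟩
      · simp [Algebra.algebraMap_eq_smul_one, hf j (by omega)]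
      · simp [Algebra.algebraMap_eq_smul_one, e]
    · intro x y k _ _ hx hy l f hf
      refine ⟨fun j hj => ?_, ?_⟩
      · rw [map_add, LinearMap.add_apply, Pi.add_apply, (hx l f hf).1 j hj, (hy l f hf).1 j hj,
          add_zero]
      · simp only [map_add, LinearMap.add_apply, Pi.add_apply, (hx l f hf).2, (hy l f hf).2,
          add_mul]
    · intro a ha k w _ hw l f hf
      obtain ⟨r, x, rfl⟩ := mem_degreeLEOne.mp ha
      obtain ⟨h1, h2⟩ := hw l f hf
      have h3 := (hw 0 e he).1
      have hstep : ∀ g j, Θ ((algebraMap K U r + UniversalEnvelopingAlgebra.ι K x) * w) g (j + 1) =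
          r • Θ w g (j + 1) + (vectorField _ (ρ x) (Θ w g (j + 1)) +
            linearFunction z (ρ x) * Θ w g j) := by
        intro g j
        rw [map_mul, map_add, Module.End.mul_apply, LinearMap.add_apply, hΘ, Pi.add_apply,
          symbolOperator_succ]
        simp [Algebra.algebraMap_eq_smul_one]
      refine ⟨fun j hj => ?_, ?_⟩
      · obtain ⟨j, rfl⟩ : ∃ i, j = i + 1 := ⟨j - 1, by omega⟩
        rw [hstep, h1 j (by omega), h1 (j + 1) (by omega)]
        simp
      · rw [Nat.succ_add, Nat.succ_eq_add_one, hstep, Nat.succ_eq_add_one, hstep, h2,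
          h1 (k + l + 1) (by omega), h3 (k + 1) (by omega)]
        simp [mul_assoc]
  -- evaluation at the identity matrix
  let ev := (MvPolynomial.aeval (R := MvPolynomial ι K)
    (fun ij : m × m => (1 : Matrix m m (MvPolynomial ι K)) ij.1 ij.2)).restrictScalars K
  refine ⟨fun k => ev.toLinearMap ∘ₗ LinearMap.proj k ∘ₗ LinearMap.applyₗ e ∘ₗ Θ.toLinearMap,
    ?_, ?_, ?_, ?_⟩
  · simp [e]
  · intro k u hu
    cases k with
    | zero =>
      rw [degreeLT, Submodule.mem_bot] at hu
      simp [hu]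
    | succ k =>
      have := (key k u hu 0 e he).1 (k + 1) (by omega)
      simp [this]
  · intro k l u hu w hw
    have := (key k u hu l (Θ w e) (fun j hj => (key l w hw 0 e he).1 j (by omega))).2
    simp only [LinearMap.comp_apply, AlgHom.toLinearMap_apply, LinearMap.applyₗ_apply_apply,
      LinearMap.proj_apply, map_mul, Module.End.mul_apply, this]
  · intro i
    have h0 : symbolOperator z (ρ (v i)) e 1 = linearFunction z (ρ (v i)) := by
      rw [← zero_add 1, symbolOperator_succ]
      simp [e]
    have h1 := eval_linearFunction z (ρ (v i))
    rw [hz] at h1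
    have h2 : ψ (ρ (v i)) = v i := LinearMap.congr_fun hψ (v i)
    simp only [LinearMap.comp_apply, AlgHom.toLinearMap_apply, LinearMap.applyₗ_apply_apply,
      LinearMap.proj_apply, hΘ, h0]
    change MvPolynomial.aeval _ _ = _
    rw [MvPolynomial.aeval_eq_eval]
    refine h1.trans ?_
    rw [h2]
    simp [lin]

end Filtration

/-! ### Bases of the enveloping algebra -/

section PBW

variable {K L ι : Type*} [Field K] [LieRing L] [LieAlgebra K L]

local notation "U" => UniversalEnvelopingAlgebra K L

/-- The product in the enveloping algebra of a list of basis vectors of the Lie algebra. -/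
def listProd (v : Basis ι K L) (l : List ι) : U :=
  (l.map fun i => UniversalEnvelopingAlgebra.ι K (v i)).prod

lemma listProd_cons (v : Basis ι K L) (i : ι) (l : List ι) :
    listProd v (i :: l) = UniversalEnvelopingAlgebra.ι K (v i) * listProd v l := by
  simp [listProd]

lemma listProd_mem (v : Basis ι K L) (l : List ι) : listProd v l ∈ degreeLE K L l.length := by
  induction l with
  | nil => exact one_mem_degreeLE 0
  | cons i l ih =>
    rw [listProd_cons, List.length_cons, add_comm]
    exact mul_mem_degreeLE (ι_mem_degreeLE _) ih

/-- Reordering the factors changes a product by terms of lower degree. -/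
lemma listProd_sub_mem_of_perm (v : Basis ι K L) {l l' : List ι} (h : l.Perm l') :
    listProd v l - listProd v l' ∈ degreeLT K L l.length := by
  induction h with
  | nil => simp
  | cons i h ih =>
    rw [listProd_cons, listProd_cons, ← mul_sub, List.length_cons, add_comm]
    exact mul_mem_degreeLT (ι_mem_degreeLE _) ih
  | swap i j l =>
    simp only [listProd_cons, List.length_cons]
    have h : UniversalEnvelopingAlgebra.ι K (v j) * (UniversalEnvelopingAlgebra.ι K (v i) *
        listProd v l) - UniversalEnvelopingAlgebra.ι K (v i) *
        (UniversalEnvelopingAlgebra.ι K (v j) * listProd v l) =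
        UniversalEnvelopingAlgebra.ι K ⁅v j, v i⁆ * listProd v l := by
      rw [LieHom.map_lie, LieRing.of_associative_ring_bracket]
      noncomm_ring
    rw [h, degreeLT, add_comm]
    exact mul_mem_degreeLE (ι_mem_degreeLE _) (listProd_mem v l)
  | trans h₁ h₂ ih₁ ih₂ =>
    rw [← h₁.length_eq] at ih₂
    rw [← sub_add_sub_cancel]
    exact add_mem ih₁ ih₂

/-- The product of basis vectors with given multiplicities, in an unspecified order. -/
def monomialProd (v : Basis ι K L) (d : ι →₀ ℕ) : U :=
  listProd v (Finsupp.toMultiset d).toList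

lemma monomialProd_mem (v : Basis ι K L) (d : ι →₀ ℕ) :
    monomialProd v d ∈ degreeLE K L d.degree := by
  have h := listProd_mem v (Finsupp.toMultiset d).toList
  rwa [Multiset.length_toList, Finsupp.card_toMultiset] at h

lemma ι_mul_monomialProd_sub_mem (v : Basis ι K L) (i : ι) (d : ι →₀ ℕ) :
    UniversalEnvelopingAlgebra.ι K (v i) * monomialProd v d - monomialProd v (d + Finsupp.single i 1)
      ∈ degreeLT K L (d.degree + 1) := by
  have h := listProd_sub_mem_of_perm v (l := i :: (Finsupp.toMultiset d).toList)
    (l' := (Finsupp.toMultiset (d + Finsupp.single i 1)).toList) (by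
      rw [← Multiset.coe_eq_coe, ← Multiset.cons_coe]
      simp [add_comm])
  rw [listProd_cons, List.length_cons, Multiset.length_toList, Finsupp.card_toMultiset] at h
  exact h

lemma degreeLE_le_span_sup (v : Basis ι K L) (k : ℕ) :
    degreeLE K L k ≤
      Submodule.span K (monomialProd v '' {d | d.degree = k}) ⊔ degreeLT K L k := by
  induction k with
  | zero =>
    intro u hu
    rw [degreeLE, pow_zero, Submodule.mem_one] at hu
    obtain ⟨r, rfl⟩ := hu
    refine Submodule.mem_sup_left ?_
    rw [Algebra.algebraMap_eq_smul_one]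
    refine Submodule.smul_mem _ _ (Submodule.subset_span ⟨0, by simp, ?_⟩)
    simp [monomialProd, listProd]
  | succ k ih =>
    rw [degreeLE, pow_succ', Submodule.mul_le]
    intro a ha w hw
    obtain ⟨r, x, rfl⟩ := mem_degreeLEOne.mp ha
    rw [add_mul]
    refine add_mem (Submodule.mem_sup_right ?_) ?_
    · rw [Algebra.algebraMap_eq_smul_one, smul_mul_assoc, one_mul]
      exact Submodule.smul_mem _ _ hw
    obtain ⟨w₁, hw₁, w₂, hw₂, rfl⟩ := Submodule.mem_sup.mp (ih hw)
    rw [mul_add]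
    refine add_mem ?_ (Submodule.mem_sup_right ?_)
    swap
    · rw [add_comm k 1]
      exact mul_mem_degreeLT (ι_mem_degreeLE x) hw₂
    clear hw hw₂ ha
    induction hw₁ using Submodule.span_induction with
    | mem w hw =>
      obtain ⟨d, hd, rfl⟩ := hw
      have hx : x ∈ Submodule.span K (Set.range v) := by rw [v.span_eq]; trivial
      induction hx using Submodule.span_induction with
      | mem x hx =>
        obtain ⟨i, rfl⟩ := hx
        rw [← add_sub_cancel (monomialProd v (d + Finsupp.single i 1))
          (UniversalEnvelopingAlgebra.ι K (v i) * _)]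
        refine add_mem (Submodule.mem_sup_left (Submodule.subset_span ⟨_, ?_, rfl⟩))
          (Submodule.mem_sup_right ?_)
        · have : d.degree = k := hd
          simp [this]
        · have := ι_mul_monomialProd_sub_mem v i d
          rwa [show d.degree = k from hd] at this
      | zero => simp
      | add x y _ _ hx hy =>
        rw [map_add, add_mul]
        exact add_mem hx hy
      | smul c x _ hx =>
        rw [map_smul, smul_mul_assoc]
        exact Submodule.smul_mem _ _ hx
    | zero => simp
    | add x y _ _ hx hy =>
      rw [mul_add]
      exact add_mem hx hy
    | smul c x _ hx =>
      rw [mul_smul_comm]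
      exact Submodule.smul_mem _ _ hx

/-- A set spans as soon as it spans modulo lower degree, for all degrees. -/
lemma span_eq_top_of_forall_le_sup {S : Set U}
    (h : ∀ k, degreeLE K L k ≤ Submodule.span K S ⊔ degreeLT K L k) : Submodule.span K S = ⊤ := by
  have key : ∀ k, degreeLE K L k ≤ Submodule.span K S := by
    intro k
    induction k with
    | zero => simpa [degreeLT] using h 0
    | succ k ih => exact (h (k + 1)).trans (sup_le le_rfl ih)
  refine eq_top_iff.mpr fun u _ => ?_
  obtain ⟨k, hk⟩ := exists_mem_degreeLE u
  exact key k hk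

/-- The spanning half of the Poincaré–Birkhoff–Witt theorem. -/
lemma span_monomialProd (v : Basis ι K L) :
    Submodule.span K (Set.range (monomialProd v)) = ⊤ :=
  span_eq_top_of_forall_le_sup fun k => (degreeLE_le_span_sup v k).trans
    (sup_le_sup_right (Submodule.span_mono (Set.image_subset_range _ _)) _)

/-- `s k` reads off the leading term of an element of degree at most `k` of the enveloping
algebra, as a polynomial in the basis vectors of the Lie algebra. -/
structure IsSymbol (v : Basis ι K L) (s : ℕ → U →ₗ[K] MvPolynomial ι K) : Prop where
  one : s 0 1 = 1
  eq_zero : ∀ k, ∀ u ∈ degreeLT K L k, s k u = 0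
  mul : ∀ k l, ∀ u ∈ degreeLE K L k, ∀ w ∈ degreeLE K L l, s (k + l) (u * w) = s k u * s l w
  ι : ∀ i, s 1 (UniversalEnvelopingAlgebra.ι K (v i)) = MvPolynomial.X i

lemma IsSymbol.listProd {v : Basis ι K L} {s : ℕ → U →ₗ[K] MvPolynomial ι K} (hs : IsSymbol v s)
    (l : List ι) : s l.length (listProd v l) = (l.map MvPolynomial.X).prod := by
  induction l with
  | nil => simpa [FaithfulPBW.listProd] using hs.one
  | cons i l ih =>
    rw [listProd_cons, List.length_cons, add_comm, hs.mul _ _ _ (ι_mem_degreeLE _) _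
      (listProd_mem v l), ih, hs.ι]
    simp

lemma IsSymbol.monomialProd {v : Basis ι K L} {s : ℕ → U →ₗ[K] MvPolynomial ι K}
    (hs : IsSymbol v s) (d : ι →₀ ℕ) :
    s d.degree (monomialProd v d) = MvPolynomial.monomial d 1 := by
  have h := hs.listProd (Finsupp.toMultiset d).toList
  rw [Multiset.length_toList, Finsupp.card_toMultiset] at h
  refine h.trans ?_
  rw [← Multiset.prod_coe, ← Multiset.map_coe, Multiset.coe_toList, Finsupp.toMultiset_map,
    Finsupp.prod_toMultiset, Finsupp.prod_mapDomain_index (by simp) (by intros; rw [pow_add]),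
    MvPolynomial.monomial_eq, map_one, one_mul]

lemma IsSymbol.pow {v : Basis ι K L} {s : ℕ → U →ₗ[K] MvPolynomial ι K} (hs : IsSymbol v s)
    {k : ℕ} {u : U} (hu : u ∈ degreeLE K L k) (l : ℕ) : s (l * k) (u ^ l) = s k u ^ l := by
  induction l with
  | zero => simpa using hs.one
  | succ l ih =>
    rw [Nat.succ_mul, pow_succ, hs.mul _ _ _ (pow_mem_degreeLE hu l) _ hu, ih, pow_succ]

/-- An element of degree at most `k` whose leading term vanishes has degree less than `k`. -/
lemma IsSymbol.mem_degreeLT {v : Basis ι K L} {s : ℕ → U →ₗ[K] MvPolynomial ι K}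
    (hs : IsSymbol v s) {k : ℕ} {u : U} (hu : u ∈ degreeLE K L k) (h : s k u = 0) :
    u ∈ degreeLT K L k := by
  obtain ⟨u₁, hu₁, u₂, hu₂, rfl⟩ := Submodule.mem_sup.mp (degreeLE_le_span_sup v k hu)
  rw [map_add, hs.eq_zero k u₂ hu₂, add_zero] at h
  obtain ⟨c, hc, rfl⟩ := (Finsupp.mem_span_image_iff_linearCombination K).mp hu₁
  have hc' : c = 0 := by
    refine (linearIndependent_iff.mp (MvPolynomial.basisMonomials ι K).linearIndependent) c ?_
    rw [Finsupp.linearCombination_apply] at h ⊢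
    rw [← h, map_finsuppSum]
    refine Finsupp.sum_congr fun d hd => ?_
    have hd' : d.degree = k := (Finsupp.mem_supported K c).mp hc hd
    rw [map_smul, ← hd', hs.monomialProd, MvPolynomial.coe_basisMonomials]
  rw [hc']
  simpa using hu₂

/-- A family of elements whose leading terms are distinct monomials is linearly independent. -/
theorem IsSymbol.linearIndependent {v : Basis ι K L} {s : ℕ → U →ₗ[K] MvPolynomial ι K}
    (hs : IsSymbol v s) {I : Type*} {e : I → U} {α : I → ι →₀ ℕ} (hα : Function.Injective α)
    (he : ∀ i, e i ∈ degreeLE K L (α i).degree)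
    (hse : ∀ i, s (α i).degree (e i) = MvPolynomial.monomial (α i) 1) : LinearIndependent K e := by
  classical
  rw [linearIndependent_iff]
  intro f hf
  by_contra hne
  -- in a nontrivial relation, the leading term of highest degree cannot cancel
  obtain ⟨i₀, hi₀, hmax⟩ := Finset.exists_max_image f.support (fun i => (α i).degree)
    (Finsupp.support_nonempty_iff.mpr hne)
  have h := congrArg (fun u => MvPolynomial.coeff (α i₀) (s (α i₀).degree u)) hf
  simp only [map_zero, MvPolynomial.coeff_zero, Finsupp.linearCombination_apply, Finsupp.sum,
    map_sum, MvPolynomial.coeff_sum, map_smul, MvPolynomial.coeff_smul] at h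
  rw [Finset.sum_eq_single i₀] at h
  · rw [hse, MvPolynomial.coeff_monomial, if_pos rfl, smul_eq_mul, mul_one] at h
    exact (Finsupp.mem_support_iff.mp hi₀) h
  · intro i hi hne
    rcases (hmax i hi).lt_or_eq with hlt | heq
    · rw [hs.eq_zero _ (e i), MvPolynomial.coeff_zero, smul_zero]
      obtain ⟨j, hj⟩ : ∃ j, (α i₀).degree = j + 1 := ⟨(α i₀).degree - 1, by omega⟩
      rw [hj]
      exact degreeLE_mono (by omega) (he i)
    · rw [← heq, hse, MvPolynomial.coeff_monomial, if_neg (fun h => hne (hα h)), smul_zero]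
  · exact fun h => absurd hi₀ h

/-- A family of elements whose leading terms are all monomials spans. -/
theorem IsSymbol.span_eq_top {v : Basis ι K L} {s : ℕ → U →ₗ[K] MvPolynomial ι K}
    (hs : IsSymbol v s) {I : Type*} {e : I → U} {α : I → ι →₀ ℕ} (hα : Function.Surjective α)
    (he : ∀ i, e i ∈ degreeLE K L (α i).degree)
    (hse : ∀ i, s (α i).degree (e i) = MvPolynomial.monomial (α i) 1) :
    Submodule.span K (Set.range e) = ⊤ := by
  refine span_eq_top_of_forall_le_sup fun k => (degreeLE_le_span_sup v k).trans
    (sup_le (Submodule.span_le.mpr ?_) le_sup_right)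
  rintro _ ⟨d, rfl, rfl⟩
  obtain ⟨i, rfl⟩ := hα d
  rw [← sub_add_cancel (FaithfulPBW.monomialProd v (α i)) (e i), add_comm]
  refine add_mem (Submodule.mem_sup_left (Submodule.subset_span ⟨i, rfl⟩))
    (Submodule.mem_sup_right ?_)
  refine hs.mem_degreeLT (sub_mem (monomialProd_mem v _) (he i)) ?_
  rw [map_sub, hs.monomialProd, hse, sub_self]

end PBW

/-! ### Jacobson's formula for `p`-th powers -/

section Jacobson

open Polynomial

variable {K : Type*} [Field K] (p : ℕ) [Fact p.Prime] [CharP K p]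

include p in
lemma neg_one_pow_mul_choose (m : ℕ) (hm : m ≤ p - 1) :
    (-1 : K) ^ m * ((p - 1).choose m : K) = 1 := by
  have hp := (Fact.out : p.Prime)
  induction m with
  | zero => simp
  | succ m ih =>
    have h : (p.choose (m + 1) : K) = 0 :=
      (CharP.cast_eq_zero_iff K p _).mpr (hp.dvd_choose_self m.succ_ne_zero (by omega))
    have h' : p.choose (m + 1) = (p - 1).choose m + (p - 1).choose (m + 1) := by
      conv_lhs => rw [← Nat.sub_add_cancel hp.one_le]
      exact Nat.choose_succ_succ _ _
    rw [h', Nat.cast_add] at h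
    rw [eq_neg_of_add_eq_zero_right h, pow_succ]
    simpa using ih (by omega)

variable {A : Type*} [Ring A] [Algebra K A]

/-- In characteristic `p`, the operator `ad(a) ^ (p - 1)` is `b ↦ ∑ a ^ i * b * a ^ (p - 1 - i)`,
because the binomial coefficients of `p - 1` are `±1`. -/
lemma ad_pow_char_sub_one (a b : A) :
    ((LinearMap.mulLeft K a - LinearMap.mulRight K a) ^ (p - 1)) b =
      ∑ i ∈ Finset.range p, a ^ i * b * a ^ (p - 1 - i) := by
  have hp := (Fact.out : p.Prime)
  have hc : Commute (LinearMap.mulLeft K a) (-LinearMap.mulRight K a) :=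
    (LinearMap.commute_mulLeft_right a a).neg_right
  rw [sub_eq_add_neg, hc.add_pow, Nat.sub_add_cancel hp.one_le, LinearMap.sum_apply]
  refine Finset.sum_congr rfl fun i hi => ?_
  have hi' : i ≤ p - 1 := by have := Finset.mem_range.mp hi; omega
  have h := neg_one_pow_mul_choose (K := K) p (p - 1 - i) (Nat.sub_le _ _)
  rw [Nat.choose_symm hi'] at h
  rw [neg_pow, LinearMap.pow_mulLeft, LinearMap.pow_mulRight]
  have h2 : ((-1 : Module.End K A) ^ (p - 1 - i) * LinearMap.mulRight K (a ^ (p - 1 - i))) *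
      ((p - 1).choose i : Module.End K A) =
      ((-1 : K) ^ (p - 1 - i) * ((p - 1).choose i : K)) •
        LinearMap.mulRight K (a ^ (p - 1 - i)) := by
    have h3 : ((p - 1).choose i : Module.End K A) =
        algebraMap K (Module.End K A) ((p - 1).choose i : K) := by rw [map_natCast]
    have h4 : (-1 : Module.End K A) ^ (p - 1 - i) =
        algebraMap K (Module.End K A) ((-1) ^ (p - 1 - i)) := by rw [map_pow, map_neg, map_one]
    rw [h3, ← Algebra.commutes, h4, ← mul_assoc, ← map_mul, mul_comm, ← Algebra.smul_def]
  rw [mul_assoc, h2, h, one_smul]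
  simp [mul_assoc]

/-- In characteristic `p`, `ad(a) ^ p = ad(a ^ p)`. -/
lemma ad_pow_char (a b : A) :
    ((LinearMap.mulLeft K a - LinearMap.mulRight K a) ^ p) b = a ^ p * b - b * a ^ p := by
  have hp := (Fact.out : p.Prime)
  conv_lhs => rw [← Nat.sub_add_cancel hp.one_le]
  rw [pow_succ', Module.End.mul_apply, ad_pow_char_sub_one]
  simp only [LinearMap.sub_apply, LinearMap.mulLeft_apply, LinearMap.mulRight_apply,
    Finset.mul_sum, Finset.sum_mul]
  have h : ∀ i ∈ Finset.range p, a * (a ^ i * b * a ^ (p - 1 - i)) -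
      a ^ i * b * a ^ (p - 1 - i) * a =
      a ^ (i + 1) * b * a ^ (p - (i + 1)) - a ^ i * b * a ^ (p - i) := by
    intro i hi
    have hi' := Finset.mem_range.mp hi
    have h1 : p - i = p - 1 - i + 1 := by omega
    have h2 : p - (i + 1) = p - 1 - i := by omega
    rw [h1, h2, pow_succ', pow_succ]
    simp only [mul_assoc]
  rw [← Finset.sum_sub_distrib, Finset.sum_congr rfl h,
    Finset.sum_range_sub (fun i => a ^ i * b * a ^ (p - i))]
  simp

variable {L : Type*} [LieRing L] [LieAlgebra K L]

/-- The coefficient of `T ^ i` in `ad(x + T y) ^ n (y)`. -/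
def adCoeff (x y : L) : ℕ → ℕ → L
  | 0, 0 => y
  | 0, _ + 1 => 0
  | n + 1, 0 => ⁅x, adCoeff x y n 0⁆
  | n + 1, i + 1 => ⁅x, adCoeff x y n (i + 1)⁆ + ⁅y, adCoeff x y n i⁆

/-- `adCoeff` computes `ad(x + T y) ^ n (y)` in every associative algebra to which the Lie algebra
maps. -/
lemma coeff_ad_pow (φ : L →ₗ⁅K⁆ A) (x y : L) (n i : ℕ) :
    (((LinearMap.mulLeft K (C (φ x) + C (φ y) * X) -
      LinearMap.mulRight K (C (φ x) + C (φ y) * X) : Module.End K A[X]) ^ n) (C (φ y))).coeff i =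
      φ (adCoeff x y n i) := by
  induction n generalizing i with
  | zero => cases i <;> simp [adCoeff, coeff_C]
  | succ n ih =>
    rw [pow_succ', Module.End.mul_apply]
    set f := ((LinearMap.mulLeft K (C (φ x) + C (φ y) * X) -
      LinearMap.mulRight K (C (φ x) + C (φ y) * X) : Module.End K A[X]) ^ n) (C (φ y))
    simp only [LinearMap.sub_apply, LinearMap.mulLeft_apply, LinearMap.mulRight_apply, add_mul,
      mul_add, coeff_sub, coeff_add, coeff_C_mul, coeff_mul_C, mul_assoc]
    cases i with
    | zero =>
      simp [adCoeff, ih, LieRing.of_associative_ring_bracket, ← mul_assoc]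
    | succ i =>
      rw [coeff_X_mul, ← mul_assoc f, coeff_mul_X, coeff_mul_C, ih, ih]
      simp only [adCoeff, map_add, LieHom.map_lie, LieRing.of_associative_ring_bracket]
      abel

lemma derivative_pow_noncomm (f : A[X]) (n : ℕ) :
    derivative (f ^ n) = ∑ i ∈ Finset.range n, f ^ i * derivative f * f ^ (n - 1 - i) := by
  induction n with
  | zero => simp
  | succ n ih =>
    rw [pow_succ, derivative_mul, ih, Finset.sum_range_succ, Finset.sum_mul]
    congr 1
    · refine Finset.sum_congr rfl fun i hi => ?_
      have hi' := Finset.mem_range.mp hi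
      have h : n + 1 - 1 - i = n - 1 - i + 1 := by omega
      rw [h, pow_succ]
      simp only [mul_assoc]
    · simp

/-- Jacobson's formula: the failure of additivity of the `p`-th power is a Lie polynomial. It holds
because the derivative of `(x + T y) ^ p` with respect to `T` is `ad(x + T y) ^ (p - 1) (y)`. -/
theorem add_pow_char_eq (φ : L →ₗ⁅K⁆ A) (x y : L) :
    (φ x + φ y) ^ p = φ x ^ p + φ y ^ p +
      φ (∑ i ∈ Finset.range (p - 1), ((i + 1 : ℕ) : K)⁻¹ • adCoeff x y (p - 1) i) := by
  have hp := (Fact.out : p.Prime)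
  -- the variable `T` commutes with all coefficients, so that `a ^ p` is computed in `A[T]`
  set a : A[X] := C (φ x) + C (φ y) * X with ha
  have hder : derivative a = C (φ y) := by
    simp [ha, derivative_mul]
  have hcoeff : ∀ i ∈ Finset.range (p - 1), (a ^ p).coeff (i + 1) =
      φ (((i + 1 : ℕ) : K)⁻¹ • adCoeff x y (p - 1) i) := by
    intro i hi
    have hi' := Finset.mem_range.mp hi
    have h := derivative_pow_noncomm a p
    rw [hder, ← ad_pow_char_sub_one (K := K)] at h
    have h' := congrArg (fun f => coeff f i) h
    simp only [coeff_derivative] at h'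
    rw [ha, coeff_ad_pow φ x y, ← ha] at h'
    have hne : ((i + 1 : ℕ) : K) ≠ 0 := by
      rw [Ne, CharP.cast_eq_zero_iff K p]
      exact Nat.not_dvd_of_pos_of_lt i.succ_pos (by omega)
    rw [map_smul, ← h', eq_inv_smul_iff₀ hne, Algebra.smul_def, map_natCast]
    rw [(Nat.cast_commute (i + 1) _).eq]
    push_cast
    rfl
  have hdeg : a.natDegree ≤ 1 := by
    refine natDegree_add_le_of_degree_le (by simp) ?_
    exact (natDegree_C_mul_le _ _).trans natDegree_X_le
  have hpow : (a ^ p).natDegree ≤ p := by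
    refine natDegree_pow_le.trans ?_
    calc p * a.natDegree ≤ p * 1 := Nat.mul_le_mul_left _ hdeg
      _ = p := mul_one p
  have heval : (a ^ p).eval 1 = (φ x + φ y) ^ p := by
    have h : ∀ f : A[X], f.eval 1 = eval₂RingHom' (RingHom.id A) 1 (fun r => Commute.one_right r) f :=
      fun f => rfl
    rw [h, map_pow, ← h]
    simp [ha]
  rw [← heval, eval_eq_sum_range' (Nat.lt_succ_of_le hpow), Nat.succ_eq_add_one,
    Finset.sum_range_succ]
  conv_lhs => rw [← Nat.sub_add_cancel hp.one_le]
  rw [Finset.sum_range_succ', Nat.sub_add_cancel hp.one_le, map_sum]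
  have h0 : (a ^ p).coeff 0 = φ x ^ p := by
    have := map_pow (constantCoeff (R := A)) a p
    simpa [ha] using this
  have h1 : (a ^ p).coeff p = φ y ^ p := by
    have := coeff_pow_of_natDegree_le (m := p) hdeg
    rw [mul_one] at this
    rw [this]
    simp [ha]
  simp only [one_pow, mul_one]
  rw [h0, h1, Finset.sum_congr rfl hcoeff]
  abel

end Jacobson

/-! ### The `p`-center of the enveloping algebra -/

section Center

variable {K : Type*} [Field K] (p : ℕ) [Fact p.Prime] [CharP K p]
variable {L : Type*} [LieRing L] [LieAlgebra K L]
variable {m : Type*} [Fintype m] [DecidableEq m]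

local notation "U" => UniversalEnvelopingAlgebra K L

lemma map_ad_pow {A : Type*} [Ring A] [Algebra K A] (φ : L →ₗ⁅K⁆ A) (x y : L) (n : ℕ) :
    ((LinearMap.mulLeft K (φ x) - LinearMap.mulRight K (φ x)) ^ n) (φ y) =
      φ ((LieAlgebra.ad K L x ^ n) y) := by
  induction n with
  | zero => simp
  | succ n ih =>
    rw [pow_succ', Module.End.mul_apply, ih, pow_succ', Module.End.mul_apply]
    simp [LieRing.of_associative_ring_bracket]

/-- `x ^ p - x^[p]` in the enveloping algebra, for a map `pm` that plays the role of
`x ↦ x^[p]`. -/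
def pCentral (pm : L → L) (x : L) : U :=
  UniversalEnvelopingAlgebra.ι K x ^ p - UniversalEnvelopingAlgebra.ι K (pm x)

variable {ρ : L →ₗ⁅K⁆ Matrix m m K} (hρ : Function.Injective ρ) {pm : L → L}
  (hpm : ∀ x, ρ (pm x) = ρ x ^ p)
include hρ hpm

/-- Jacobson's formula holds with the same correction term in the enveloping algebra and for the
matrices `ρ x`, where it computes `pm (x + y)`; so the correction terms cancel. -/
lemma pCentral_add (x y : L) :
    pCentral (K := K) p pm (x + y) = pCentral p pm x + pCentral p pm y := by
  have h1 := add_pow_char_eq p ρ x y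
  have h2 := add_pow_char_eq p (UniversalEnvelopingAlgebra.ι K : L →ₗ⁅K⁆ U) x y
  set S := ∑ i ∈ Finset.range (p - 1), ((i + 1 : ℕ) : K)⁻¹ • adCoeff x y (p - 1) i
  have h3 : pm (x + y) = pm x + pm y + S := by
    apply hρ
    rw [hpm, map_add, h1, map_add, map_add, hpm, hpm]
  rw [pCentral, map_add, h2, h3, map_add, map_add, pCentral, pCentral]
  abel

omit [Fact p.Prime] [CharP K p] in
lemma pCentral_smul (c : K) (x : L) :
    pCentral (K := K) p pm (c • x) = c ^ p • pCentral p pm x := by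
  have h3 : pm (c • x) = c ^ p • pm x := by
    apply hρ
    rw [hpm, map_smul, map_smul, hpm, smul_pow]
  rw [pCentral, map_smul, h3, map_smul, smul_pow, pCentral, smul_sub]

lemma pCentral_sum {J : Type*} (s : Finset J) (c : J → K) (x : J → L) :
    pCentral (K := K) p pm (∑ j ∈ s, c j • x j) = ∑ j ∈ s, c j ^ p • pCentral p pm (x j) := by
  classical
  induction s using Finset.induction_on with
  | empty =>
    have := pCentral_smul p hρ hpm (0 : K) (0 : L)
    rwa [smul_zero, zero_pow (Fact.out : p.Prime).ne_zero, zero_smul] at this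
  | insert j s hj ih =>
    rw [Finset.sum_insert hj, Finset.sum_insert hj, pCentral_add p hρ hpm, pCentral_smul p hρ hpm,
      ih]

/-- `x ^ p - x^[p]` is central: in the enveloping algebra `ad(x ^ p)` is `ad(x) ^ p`, and comparison
with the faithful matrices `ρ x` shows that `ad(x) ^ p = ad(x^[p])` on the Lie algebra. -/
lemma pCentral_mem_center (x : L) : pCentral p pm x ∈ Subalgebra.center K U := by
  have h : ∀ y : L, pCentral p pm x * UniversalEnvelopingAlgebra.ι K y =
      UniversalEnvelopingAlgebra.ι K y * pCentral p pm x := by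
    intro y
    have h1 := ad_pow_char (K := K) p (UniversalEnvelopingAlgebra.ι K x : U)
      (UniversalEnvelopingAlgebra.ι K y)
    have h2 := ad_pow_char (K := K) p (ρ x) (ρ y)
    rw [map_ad_pow] at h1 h2
    have h3 : (LieAlgebra.ad K L x ^ p) y = ⁅pm x, y⁆ := by
      apply hρ
      rw [h2, LieHom.map_lie, hpm, Ring.lie_def]
    rw [h3, LieHom.map_lie, LieRing.of_associative_ring_bracket] at h1
    rw [pCentral, sub_mul, mul_sub, sub_eq_sub_iff_sub_eq_sub]
    exact h1.symm
  rw [Subalgebra.mem_center_iff]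
  intro u
  have hu : u ∈ Algebra.adjoin K (Set.range (UniversalEnvelopingAlgebra.ι K : L → U)) := by
    rw [adjoin_range_ι]; trivial
  induction hu using Algebra.adjoin_induction with
  | mem u hu =>
    obtain ⟨y, rfl⟩ := hu
    exact (h y).symm
  | algebraMap r => exact Algebra.commutes r _
  | add u w _ _ hu hw => rw [add_mul, mul_add, hu, hw]
  | mul u w _ _ hu hw => rw [mul_assoc, hw, ← mul_assoc, hu, mul_assoc]

omit hρ hpm [CharP K p] in
lemma pCentral_mem_degreeLE (x : L) : pCentral (K := K) p pm x ∈ degreeLE K L p := by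
  have h1 := pow_mem_degreeLE (ι_mem_degreeLE (K := K) x) p
  rw [mul_one] at h1
  exact sub_mem h1 (degreeLE_mono (Fact.out : p.Prime).one_le (ι_mem_degreeLE _))

omit hρ hpm [CharP K p] in
lemma IsSymbol.pCentral {ι : Type*} {v : Basis ι K L} {s : ℕ → U →ₗ[K] MvPolynomial ι K}
    (hs : IsSymbol v s) (i : ι) :
    s p (pCentral p pm (v i)) = MvPolynomial.X i ^ p := by
  have h1 := hs.pow (ι_mem_degreeLE (K := K) (v i)) p
  rw [mul_one, hs.ι] at h1
  rw [FaithfulPBW.pCentral, map_sub, h1, hs.eq_zero p, sub_zero]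
  obtain ⟨j, hj⟩ : ∃ j, p = j + 2 := ⟨p - 2, by have := (Fact.out : p.Prime).two_le; omega⟩
  rw [hj]
  exact degreeLE_mono (by omega) (ι_mem_degreeLE _)

end Center

/-! ### Freeness over the `p`-center and a subalgebra -/

open TensorProduct

/-- A restricted Lie algebra `L` of matrices with a restricted subalgebra `sub`, a basis of `L` that
extends a basis of `sub` (indexed by `H`) by vectors indexed by `J`, and a one-dimensional
restricted module of `sub`. -/
structure InductionData (p : ℕ) (K L J H m : Type*) [Field K] [LieRing L] [LieAlgebra K L]
    [Fintype m] [DecidableEq m] where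
  /-- the faithful matrix representation -/
  ρ : L →ₗ⁅K⁆ Matrix m m K
  ρ_injective : Function.Injective ρ
  /-- the `p`-th power map -/
  pm : L → L
  ρ_pm : ∀ x, ρ (pm x) = ρ x ^ p
  /-- the subalgebra -/
  sub : LieSubalgebra K L
  pm_mem : ∀ x ∈ sub, pm x ∈ sub
  /-- the basis of the Lie algebra -/
  v : Basis (J ⊕ H) K L
  /-- the basis of the subalgebra -/
  w : Basis H K sub
  w_eq : ∀ h, (w h : L) = v (Sum.inr h)
  /-- the scalars by which the subalgebra acts -/
  act : sub →ₗ⁅K⁆ K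
  act_pm : ∀ x : sub, act x ^ p = act ⟨pm x, pm_mem x x.2⟩

namespace InductionData

variable {p : ℕ} [Fact p.Prime] {K L J H m : Type*} [Field K] [CharP K p] [LieRing L]
  [LieAlgebra K L] [Fintype m] [DecidableEq m] (D : InductionData p K L J H m)

local notation "U" => UniversalEnvelopingAlgebra K L

/-- The enveloping algebra of the subalgebra, mapped to the enveloping algebra of `L`. -/
def subHom : UniversalEnvelopingAlgebra K D.sub →ₐ[K] U :=
  UniversalEnvelopingAlgebra.lift K ((UniversalEnvelopingAlgebra.ι K).comp D.sub.incl)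

omit [Fact p.Prime] [CharP K p] in
lemma subHom_ι (x : D.sub) :
    D.subHom (UniversalEnvelopingAlgebra.ι K x) = UniversalEnvelopingAlgebra.ι K (x : L) := by
  rw [subHom, UniversalEnvelopingAlgebra.lift_ι_apply]
  rfl

/-- The polynomials in the central elements `x ^ p - x^[p]`, where `x` runs over the basis vectors
that complement the subalgebra. -/
def centralHom : MvPolynomial J K →ₐ[K] U :=
  (Subalgebra.center K U).val.comp (MvPolynomial.aeval fun i =>
    (⟨pCentral p D.pm (D.v (Sum.inl i)), pCentral_mem_center p D.ρ_injective D.ρ_pm _⟩ :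
      Subalgebra.center K U))

lemma centralHom_X (i : J) :
    D.centralHom (MvPolynomial.X i) = pCentral p D.pm (D.v (Sum.inl i)) := by
  simp [centralHom]

lemma centralHom_commute (P : MvPolynomial J K) (u : U) : Commute (D.centralHom P) u := by
  have : D.centralHom P ∈ Subalgebra.center K U := by
    rw [centralHom, AlgHom.comp_apply]
    exact Subtype.property _
  exact ((Subalgebra.mem_center_iff.mp this) u).symm

/-- The algebra over which the enveloping algebra of `L` is free of finite rank, as a right
module: polynomials in the central elements `x ^ p - x^[p]` with coefficients in the enveloping
algebra of the subalgebra. -/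
abbrev Base : Type _ := MvPolynomial J K ⊗[K] UniversalEnvelopingAlgebra K D.sub

/-- The map from `Base` to the enveloping algebra. -/
def baseHom : D.Base →ₐ[K] U :=
  Algebra.TensorProduct.lift D.centralHom D.subHom fun P _ => D.centralHom_commute P _

lemma baseHom_tmul (P : MvPolynomial J K) (u : UniversalEnvelopingAlgebra K D.sub) :
    D.baseHom (P ⊗ₜ u) = D.centralHom P * D.subHom u := by
  simp [baseHom]

section Independence

variable [Fintype J]

/-- The monomial with the exponents `a`, all of them less than `p`, in the basis vectors that
complement the subalgebra. -/
def truncatedProd (a : J → Fin p) : U :=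
  monomialProd D.v (Finsupp.mapDomain Sum.inl (Finsupp.equivFunOnFinite.symm fun i => (a i : ℕ)))

/-- The exponents of the leading monomial of
`truncatedProd a * baseHom (monomial b ⊗ monomialProd c)`. -/
def leadingExponent (i : (J → Fin p) × (J →₀ ℕ) × (H →₀ ℕ)) : J ⊕ H →₀ ℕ :=
  Finsupp.mapDomain Sum.inl (Finsupp.equivFunOnFinite.symm fun j => (i.1 j : ℕ)) +
    (Finsupp.mapDomain Sum.inl (p • i.2.1) + Finsupp.mapDomain Sum.inr i.2.2)

omit [Fact p.Prime] in
lemma leadingExponent_inl (i : (J → Fin p) × (J →₀ ℕ) × (H →₀ ℕ)) (j : J) :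
    leadingExponent i (Sum.inl j) = (i.1 j : ℕ) + p * i.2.1 j := by
  simp only [leadingExponent, Finsupp.add_apply, Finsupp.mapDomain_apply Sum.inl_injective]
  rw [Finsupp.mapDomain_of_notMem_range _ _ (by simp)]
  simp

omit [Fact p.Prime] in
lemma leadingExponent_inr (i : (J → Fin p) × (J →₀ ℕ) × (H →₀ ℕ)) (h : H) :
    leadingExponent i (Sum.inr h) = i.2.2 h := by
  simp only [leadingExponent, Finsupp.add_apply, Finsupp.mapDomain_apply Sum.inr_injective]
  rw [Finsupp.mapDomain_of_notMem_range _ _ (by simp),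
    Finsupp.mapDomain_of_notMem_range _ _ (by simp)]
  simp

lemma leadingExponent_injective :
    Function.Injective (leadingExponent (p := p) (J := J) (H := H)) := by
  rintro ⟨a, b, c⟩ ⟨a', b', c'⟩ h
  have hp := (Fact.out : p.Prime).pos
  have h1 : ∀ j, (a j : ℕ) + p * b j = (a' j : ℕ) + p * b' j := fun j => by
    have := DFunLike.congr_fun h (Sum.inl j)
    rwa [leadingExponent_inl, leadingExponent_inl] at this
  have ha : a = a' := by
    funext j
    have := congrArg (· % p) (h1 j)
    simp only [Nat.add_mul_mod_self_left, Nat.mod_eq_of_lt (a j).2,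
      Nat.mod_eq_of_lt (a' j).2] at this
    exact Fin.ext this
  have hb : b = b' := by
    ext j
    have := h1 j
    rw [ha] at this
    exact Nat.eq_of_mul_eq_mul_left hp (Nat.add_left_cancel this)
  have hc : c = c' := by
    ext j
    have := DFunLike.congr_fun h (Sum.inr j)
    rwa [leadingExponent_inr, leadingExponent_inr] at this
  rw [ha, hb, hc]

lemma leadingExponent_surjective [Finite H] :
    Function.Surjective (leadingExponent (p := p) (J := J) (H := H)) := by
  intro d
  have hp := (Fact.out : p.Prime).pos
  refine ⟨(fun j => ⟨d (Sum.inl j) % p, Nat.mod_lt _ hp⟩,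
    Finsupp.equivFunOnFinite.symm fun j => d (Sum.inl j) / p,
    Finsupp.equivFunOnFinite.symm fun h => d (Sum.inr h)), ?_⟩
  ext (j | h)
  · rw [leadingExponent_inl]
    exact Nat.mod_add_div _ _
  · rw [leadingExponent_inr]
    rfl

/-- The images under `freeMap` of the vectors of `(J → Fin p) → Base` that have a single nonzero
coordinate, a monomial in `K[ξ]` tensored with a product of basis vectors of the
subalgebra. -/
def pbwFamily (i : (J → Fin p) × (J →₀ ℕ) × (H →₀ ℕ)) : U :=
  D.truncatedProd i.1 * D.baseHom (MvPolynomial.monomial i.2.1 1 ⊗ₜ monomialProd D.w i.2.2)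

variable {D}

omit [Fintype J] in
lemma centralHom_monomial {s : ℕ → U →ₗ[K] MvPolynomial (J ⊕ H) K} (hs : IsSymbol D.v s)
    (b : J →₀ ℕ) :
    D.centralHom (MvPolynomial.monomial b 1) ∈
        degreeLE K L (Finsupp.mapDomain (Sum.inl (β := H)) (p • b)).degree ∧
      s (Finsupp.mapDomain (Sum.inl (β := H)) (p • b)).degree
        (D.centralHom (MvPolynomial.monomial b 1)) =
        (MvPolynomial.monomial (Finsupp.mapDomain Sum.inl (p • b)) 1 :
          MvPolynomial (J ⊕ H) K) := by
  induction b using Finsupp.induction_linear with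
  | zero =>
    refine ⟨?_, ?_⟩
    · simpa using one_mem_degreeLE 0
    · simpa using hs.one
  | add b b' hb hb' =>
    have h : (MvPolynomial.monomial (b + b') (1 : K)) =
        MvPolynomial.monomial b 1 * MvPolynomial.monomial b' 1 := by
      rw [MvPolynomial.monomial_mul, one_mul]
    rw [smul_add, Finsupp.mapDomain_add, map_add Finsupp.degree, h, map_mul D.centralHom]
    refine ⟨mul_mem_degreeLE hb.1 hb'.1, ?_⟩
    rw [hs.mul _ _ _ hb.1 _ hb'.1, hb.2, hb'.2, MvPolynomial.monomial_mul, one_mul]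
  | single i n =>
    have h : MvPolynomial.monomial (Finsupp.single i n) (1 : K) = MvPolynomial.X i ^ n := by
      rw [MvPolynomial.X_pow_eq_monomial]
    have hmem := pCentral_mem_degreeLE (K := K) p (pm := D.pm) (D.v (Sum.inl i))
    have h1 := hs.pow hmem n
    have hdeg : (Finsupp.mapDomain (Sum.inl (β := H)) (p • Finsupp.single i n)).degree = n * p := by
      rw [Finsupp.smul_single, Finsupp.mapDomain_single, Finsupp.degree_single, smul_eq_mul,
        mul_comm]
    rw [hdeg, h, map_pow, centralHom_X]
    refine ⟨pow_mem_degreeLE hmem n, ?_⟩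
    rw [h1, hs.pCentral p, ← pow_mul, MvPolynomial.X_pow_eq_monomial, Finsupp.smul_single,
      Finsupp.mapDomain_single, smul_eq_mul]

omit [Fact p.Prime] [CharP K p] [Fintype J] in
lemma subHom_monomialProd {s : ℕ → U →ₗ[K] MvPolynomial (J ⊕ H) K} (hs : IsSymbol D.v s)
    (c : H →₀ ℕ) :
    D.subHom (monomialProd D.w c) ∈
        degreeLE K L (Finsupp.mapDomain (Sum.inr (α := J)) c).degree ∧
      s (Finsupp.mapDomain (Sum.inr (α := J)) c).degree (D.subHom (monomialProd D.w c)) =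
        (MvPolynomial.monomial (Finsupp.mapDomain Sum.inr c) 1 : MvPolynomial (J ⊕ H) K) := by
  have hlist : ∀ l : List H, D.subHom (listProd D.w l) = listProd D.v (l.map Sum.inr) := by
    intro l
    simp only [listProd, map_list_prod, List.map_map, Function.comp_def, subHom_ι, D.w_eq]
  have hdeg : (Finsupp.mapDomain (Sum.inr (α := J)) c).degree =
      ((Finsupp.toMultiset c).toList.map (Sum.inr (α := J))).length := by
    rw [List.length_map, Multiset.length_toList, ← Multiset.card_map (Sum.inr (α := J)),
      Finsupp.toMultiset_map, Finsupp.card_toMultiset]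
    rfl
  rw [monomialProd, hlist, hdeg]
  refine ⟨listProd_mem _ _, ?_⟩
  rw [hs.listProd, List.map_map, ← Multiset.prod_coe, ← Multiset.map_coe, Multiset.coe_toList,
    ← Multiset.map_map, Finsupp.toMultiset_map, Finsupp.toMultiset_map,
    Finsupp.prod_toMultiset, Finsupp.prod_mapDomain_index (by simp) (by intros; rw [pow_add]),
    MvPolynomial.monomial_eq, map_one, one_mul]

lemma pbwFamily_spec {s : ℕ → U →ₗ[K] MvPolynomial (J ⊕ H) K} (hs : IsSymbol D.v s)
    (i : (J → Fin p) × (J →₀ ℕ) × (H →₀ ℕ)) :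
    D.pbwFamily i ∈ degreeLE K L (leadingExponent i).degree ∧
      s (leadingExponent i).degree (D.pbwFamily i) =
        MvPolynomial.monomial (leadingExponent i) 1 := by
  have h1 := monomialProd_mem D.v (Finsupp.mapDomain Sum.inl
    (Finsupp.equivFunOnFinite.symm fun j => (i.1 j : ℕ)))
  have h1' := hs.monomialProd (Finsupp.mapDomain Sum.inl
    (Finsupp.equivFunOnFinite.symm fun j => (i.1 j : ℕ)))
  obtain ⟨h2, h2'⟩ := centralHom_monomial hs i.2.1
  obtain ⟨h3, h3'⟩ := subHom_monomialProd hs i.2.2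
  rw [pbwFamily, truncatedProd, baseHom_tmul, leadingExponent, map_add Finsupp.degree,
    map_add Finsupp.degree]
  refine ⟨mul_mem_degreeLE h1 (mul_mem_degreeLE h2 h3), ?_⟩
  rw [hs.mul _ _ _ h1 _ (mul_mem_degreeLE h2 h3), hs.mul _ _ _ h2 _ h3, h1', h2',
    h3', MvPolynomial.monomial_mul, MvPolynomial.monomial_mul, one_mul, one_mul]

end Independence

section Free

variable [Fintype J] [DecidableEq J]

/-- The map `f ↦ ∑ truncatedProd a * baseHom (f a)`. -/
def freeMap : ((J → Fin p) → D.Base) →ₗ[K] U :=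
  ∑ a, LinearMap.mulLeft K (D.truncatedProd a) ∘ₗ D.baseHom.toLinearMap ∘ₗ LinearMap.proj a

lemma freeMap_apply (f : (J → Fin p) → D.Base) :
    D.freeMap f = ∑ a, D.truncatedProd a * D.baseHom (f a) := by
  simp [freeMap]

lemma freeMap_single (a : J → Fin p) (w : D.Base) :
    D.freeMap (Pi.single a w) = D.truncatedProd a * D.baseHom w := by
  rw [freeMap_apply, Finset.sum_eq_single a]
  · simp
  · intro a' _ h
    simp [h]
  · simp

lemma freeMap_mul (f : (J → Fin p) → D.Base) (w : D.Base) :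
    D.freeMap (fun a => f a * w) = D.freeMap f * D.baseHom w := by
  simp [freeMap_apply, Finset.sum_mul, mul_assoc]

/-- The enveloping algebra of `L` is a free right module over `Base` with basis the monomials with
exponents less than `p` in the vectors that complement the subalgebra. The leading terms of
`pbwFamily` are all monomials, each of them once: exponents are divided with remainder by `p`. -/
theorem freeMap_bijective [Finite H] : Function.Bijective D.freeMap := by
  obtain ⟨s, h1, h2, h3, h4⟩ := exists_symbol D.ρ D.ρ_injective D.v
  have hs : IsSymbol D.v s := ⟨h1, h2, h3, h4⟩
  -- `g` is only shown to span; that it is a basis follows from the independence of its images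
  let g : (J → Fin p) × (J →₀ ℕ) × (H →₀ ℕ) → ((J → Fin p) → D.Base) := fun i =>
    Pi.single i.1 (MvPolynomial.monomial i.2.1 1 ⊗ₜ monomialProd D.w i.2.2)
  have hg : ∀ i, D.freeMap (g i) = D.pbwFamily i := fun i => D.freeMap_single _ _
  have hspan : Submodule.span K (Set.range g) = ⊤ := by
    have hbase : Submodule.span K (Set.image2 (fun P u => P ⊗ₜ[K] u)
        (Set.range fun b : J →₀ ℕ => (MvPolynomial.monomial b 1 : MvPolynomial J K))
        (Set.range (monomialProd D.w))) = (⊤ : Submodule K D.Base) := by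
      have := Submodule.map₂_span_span K
        (TensorProduct.mk K (MvPolynomial J K) (UniversalEnvelopingAlgebra K D.sub))
        (Set.range fun b : J →₀ ℕ => (MvPolynomial.monomial b 1 : MvPolynomial J K))
        (Set.range (monomialProd D.w))
      rw [span_monomialProd, ← MvPolynomial.coe_basisMonomials, Basis.span_eq,
        TensorProduct.map₂_mk_top_top_eq_top] at this
      exact this.symm
    refine eq_top_iff.mpr fun f _ => ?_
    rw [← Finset.univ_sum_single f]
    refine Submodule.sum_mem _ fun a _ => ?_
    generalize f a = x
    have ha : x ∈ (⊤ : Submodule K D.Base) := trivial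
    rw [← hbase] at ha
    induction ha using Submodule.span_induction with
    | mem x hx =>
      obtain ⟨_, ⟨b, rfl⟩, _, ⟨c, rfl⟩, rfl⟩ := hx
      exact Submodule.subset_span ⟨(a, b, c), rfl⟩
    | zero => simp
    | add x y _ _ hx hy =>
      rw [Pi.single_add]
      exact add_mem hx hy
    | smul c x _ hx =>
      rw [Pi.single_smul]
      exact Submodule.smul_mem _ _ hx
  constructor
  · have hli : LinearIndependent K D.pbwFamily :=
      hs.linearIndependent leadingExponent_injective (fun i => (pbwFamily_spec hs i).1)
        fun i => (pbwFamily_spec hs i).2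
    have hsurj : Function.Surjective (Finsupp.linearCombination K g) := by
      rw [← LinearMap.range_eq_top, Finsupp.range_linearCombination, hspan]
    have hcomp : D.freeMap ∘ₗ Finsupp.linearCombination K g =
        Finsupp.linearCombination K D.pbwFamily := by
      ext i
      simp [hg]
    have hinj : Function.Injective (D.freeMap ∘ Finsupp.linearCombination K g) := by
      rw [← LinearMap.coe_comp, hcomp]
      exact hli
    intro f f' h
    obtain ⟨c, rfl⟩ := hsurj f
    obtain ⟨c', rfl⟩ := hsurj f'
    rw [hinj h]
  · rw [← LinearMap.range_eq_top, eq_top_iff,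
      ← hs.span_eq_top (e := D.pbwFamily) leadingExponent_surjective
        (fun i => (pbwFamily_spec hs i).1) fun i => (pbwFamily_spec hs i).2, Submodule.span_le]
    rintro _ ⟨i, rfl⟩
    exact ⟨g i, hg i⟩

end Free

/-! ### Specialization of the central elements -/

section Specialization

/-- The character of `Base` with values in the polynomials in the central elements by which the
enveloping algebra of the subalgebra acts on the one-dimensional module. -/
def baseChar : D.Base →ₐ[K] MvPolynomial J K :=
  Algebra.TensorProduct.lift (AlgHom.id K _)
    ((Algebra.ofId K _).comp (UniversalEnvelopingAlgebra.lift K D.act)) fun _ _ => Commute.all _ _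

/-- The character of `Base` obtained from `baseChar` by giving the central elements the
values `τ`. -/
def baseEval (τ : J → K) : D.Base →ₐ[K] K := (MvPolynomial.aeval τ).comp D.baseChar

omit [Fact p.Prime] [CharP K p] in
lemma baseEval_apply (τ : J → K) (w : D.Base) :
    D.baseEval τ w = MvPolynomial.eval τ (D.baseChar w) := by
  rw [baseEval, AlgHom.comp_apply, MvPolynomial.aeval_eq_eval]

omit [Fact p.Prime] [CharP K p] in
lemma baseEval_ι (τ : J → K) (x : D.sub) :
    D.baseEval τ (1 ⊗ₜ UniversalEnvelopingAlgebra.ι K x) = D.act x := by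
  rw [baseEval, AlgHom.comp_apply, baseChar, Algebra.TensorProduct.lift_tmul, AlgHom.comp_apply,
    UniversalEnvelopingAlgebra.lift_ι_apply, map_one, one_mul, Algebra.ofId_apply,
    AlgHom.commutes]
  rfl

omit [Fact p.Prime] [CharP K p] in
lemma baseEval_X (τ : J → K) (i : J) :
    D.baseEval τ (MvPolynomial.X i ⊗ₜ 1) = τ i := by
  simp [baseEval, baseChar]

lemma baseHom_ι (x : D.sub) :
    D.baseHom (1 ⊗ₜ UniversalEnvelopingAlgebra.ι K x) = UniversalEnvelopingAlgebra.ι K (x : L) := by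
  rw [baseHom_tmul, map_one, one_mul, subHom_ι]

lemma baseHom_X (i : J) :
    D.baseHom (MvPolynomial.X i ⊗ₜ 1) = pCentral p D.pm (D.v (Sum.inl i)) := by
  rw [baseHom_tmul, map_one, mul_one, centralHom_X]

variable [Fintype J] [DecidableEq J] [Finite H]

/-- `freeMap` as an equivalence; its inverse takes the coordinates of an element. -/
def freeEquiv : ((J → Fin p) → D.Base) ≃ₗ[K] U :=
  LinearEquiv.ofBijective D.freeMap D.freeMap_bijective

lemma freeEquiv_symm_mul (u : U) (w : D.Base) :
    D.freeEquiv.symm (u * D.baseHom w) = fun a => D.freeEquiv.symm u a * w := by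
  rw [LinearEquiv.symm_apply_eq]
  change _ = D.freeMap _
  rw [freeMap_mul]
  congr 1
  exact (D.freeEquiv.apply_symm_apply u).symm

lemma freeEquiv_symm_truncatedProd (a : J → Fin p) :
    D.freeEquiv.symm (D.truncatedProd a) = Pi.single a 1 := by
  rw [LinearEquiv.symm_apply_eq]
  change _ = D.freeMap _
  rw [freeMap_single, map_one, mul_one]

/-- The coordinates of an element of the enveloping algebra, when the central elements are given
the values `τ` and the subalgebra acts by its character. -/
def specialize (τ : J → K) : U →ₗ[K] ((J → Fin p) → K) :=
  LinearMap.pi (fun a => (D.baseEval τ).toLinearMap ∘ₗ LinearMap.proj a) ∘ₗ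
    D.freeEquiv.symm.toLinearMap

lemma specialize_apply (τ : J → K) (u : U) (a : J → Fin p) :
    D.specialize τ u a = D.baseEval τ (D.freeEquiv.symm u a) := rfl

lemma specialize_mul (τ : J → K) (u : U) (w : D.Base) :
    D.specialize τ (u * D.baseHom w) = D.baseEval τ w • D.specialize τ u := by
  funext a
  rw [specialize_apply, freeEquiv_symm_mul, map_mul, Pi.smul_apply, specialize_apply, smul_eq_mul,
    mul_comm]

lemma specialize_truncatedProd (τ : J → K) (a : J → Fin p) :
    D.specialize τ (D.truncatedProd a) = Pi.single a 1 := by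
  funext a'
  rw [specialize_apply, freeEquiv_symm_truncatedProd]
  by_cases h : a' = a
  · subst h; simp
  · simp [h]

/-- The matrix of the action of `x`, with entries that are polynomials in the central elements. -/
def actionMatrix (x : L) : Matrix (J → Fin p) (J → Fin p) (MvPolynomial J K) :=
  fun a' a => D.baseChar
    (D.freeEquiv.symm (UniversalEnvelopingAlgebra.ι K x * D.truncatedProd a) a')

lemma eq_sum_truncatedProd (u : U) :
    u = ∑ a, D.truncatedProd a * D.baseHom (D.freeEquiv.symm u a) := by
  rw [← freeMap_apply]
  exact (D.freeEquiv.apply_symm_apply u).symm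

lemma specialize_ι_mul (τ : J → K) (x : L) (u : U) :
    D.specialize τ (UniversalEnvelopingAlgebra.ι K x * u) =
      ((D.actionMatrix x).map (MvPolynomial.eval τ)).mulVec (D.specialize τ u) := by
  conv_lhs => rw [D.eq_sum_truncatedProd u]
  simp only [Finset.mul_sum, ← mul_assoc, map_sum, specialize_mul]
  funext a'
  simp only [Finset.sum_apply, Pi.smul_apply, smul_eq_mul, Matrix.mulVec, dotProduct,
    Matrix.map_apply, actionMatrix, specialize_apply, ← baseEval_apply]
  exact Finset.sum_congr rfl fun a _ => mul_comm _ _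

/-- The kernel of `specialize` is a left ideal, because left multiplication by elements of the Lie
algebra acts on the values of `specialize` by matrices. -/
lemma specialize_mul_congr (τ : J → K) (u : U) {w w' : U}
    (h : D.specialize τ w = D.specialize τ w') :
    D.specialize τ (u * w) = D.specialize τ (u * w') := by
  have hu : u ∈ Algebra.adjoin K (Set.range (UniversalEnvelopingAlgebra.ι K : L → U)) := by
    rw [adjoin_range_ι]; trivial
  induction hu using Algebra.adjoin_induction generalizing w w' with
  | mem u hu =>
    obtain ⟨x, rfl⟩ := hu
    rw [specialize_ι_mul, specialize_ι_mul, h]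
  | algebraMap r =>
    rw [Algebra.algebraMap_eq_smul_one, smul_mul_assoc, one_mul, smul_mul_assoc, one_mul, map_smul,
      map_smul, h]
  | add u u' _ _ hu hu' => rw [add_mul, add_mul, map_add, map_add, hu h, hu' h]
  | mul u u' _ _ hu hu' =>
    rw [mul_assoc, mul_assoc]
    exact hu (hu' h)

/-- The linear section of `specialize` with values in the span of the truncated monomials. -/
def unspecialize : ((J → Fin p) → K) →ₗ[K] U :=
  Fintype.linearCombination K D.truncatedProd

lemma specialize_unspecialize (τ : J → K) (f : (J → Fin p) → K) :
    D.specialize τ (D.unspecialize f) = f := by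
  rw [unspecialize, Fintype.linearCombination_apply, map_sum]
  simp only [map_smul, specialize_truncatedProd]
  funext a
  simp [Finset.sum_apply, Pi.single_apply]

/-- The representation of the enveloping algebra on `K ^ (J → Fin p)` for which `specialize` is
equivariant. -/
def rep (τ : J → K) : U →ₐ[K] Module.End K ((J → Fin p) → K) :=
  AlgHom.ofLinearMap
    (LinearMap.mk₂ K (fun u f => D.specialize τ (u * D.unspecialize f))
      (fun u u' f => by rw [add_mul, map_add])
      (fun c u f => by rw [smul_mul_assoc, map_smul])
      (fun u f f' => by rw [map_add, mul_add, map_add])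
      (fun c u f => by rw [map_smul, mul_smul_comm, map_smul]))
    (by
      refine LinearMap.ext fun f => ?_
      rw [LinearMap.mk₂_apply, one_mul, specialize_unspecialize]
      rfl)
    (fun u u' => by
      refine LinearMap.ext fun f => ?_
      simp only [LinearMap.mk₂_apply, Module.End.mul_apply, mul_assoc]
      exact D.specialize_mul_congr τ u (D.specialize_unspecialize τ _).symm)

lemma rep_specialize (τ : J → K) (u w : U) :
    D.rep τ u (D.specialize τ w) = D.specialize τ (u * w) :=
  D.specialize_mul_congr τ u (D.specialize_unspecialize τ _)

lemma specialize_surjective (τ : J → K) : Function.Surjective (D.specialize τ) :=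
  fun f => ⟨_, D.specialize_unspecialize τ f⟩

lemma rep_ι (τ : J → K) (x : L) (f : (J → Fin p) → K) :
    D.rep τ (UniversalEnvelopingAlgebra.ι K x) f =
      ((D.actionMatrix x).map (MvPolynomial.eval τ)).mulVec f := by
  obtain ⟨u, rfl⟩ := D.specialize_surjective τ f
  rw [rep_specialize, specialize_ι_mul]

lemma rep_one (τ : J → K) (u : U) : D.rep τ u (D.specialize τ 1) = D.specialize τ u := by
  rw [rep_specialize, mul_one]

lemma specialize_ι_of_mem (τ : J → K) (u : U) (x : D.sub) :
    D.specialize τ (u * (UniversalEnvelopingAlgebra.ι K (x : L))) =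
      D.act x • D.specialize τ u := by
  rw [← baseHom_ι, specialize_mul, baseEval_ι]

/-- The relation `x ^ p - x^[p] = χ(x) ^ p` holds for all `x` as soon as it holds for the basis
vectors that complement the subalgebra. -/
lemma rep_pCentral (χ : L →ₗ[K] K) (hχ : ∀ x ∈ D.sub, χ x = 0) (x : L) :
    D.rep (fun i => χ (D.v (Sum.inl i)) ^ p) (pCentral p D.pm x) = algebraMap K _ (χ x ^ p) := by
  classical
  have := Fintype.ofFinite H
  set τ : J → K := fun i => χ (D.v (Sum.inl i)) ^ p with hτ
  have hv : ∀ h, D.v (Sum.inr h) ∈ D.sub := fun h => by rw [← D.w_eq]; exact (D.w h).2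
  have hx : (pCentral p D.pm x : U) = ∑ k, D.v.repr x k ^ p • pCentral p D.pm (D.v k) := by
    conv_lhs => rw [← D.v.sum_repr x]
    exact pCentral_sum p D.ρ_injective D.ρ_pm _ _ _
  have hchi : χ x ^ p = ∑ i, D.v.repr x (Sum.inl i) ^ p * τ i := by
    have h : χ x = ∑ k, D.v.repr x k * χ (D.v k) := by
      conv_lhs => rw [← D.v.sum_repr x]
      simp only [map_sum, map_smul, smul_eq_mul]
    rw [h, sum_pow_char, Fintype.sum_sum_type]
    simp [hχ _ (hv _), mul_pow, hτ, (Fact.out : p.Prime).ne_zero]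
  have hcomm : ∀ (y : L) (u : U), (pCentral p D.pm y : U) * u = u * pCentral p D.pm y := fun y u =>
    ((Subalgebra.mem_center_iff.mp (pCentral_mem_center p D.ρ_injective D.ρ_pm y)) u).symm
  -- central elements can be moved to the right, where `Base` acts by its character
  have hl : ∀ i, D.rep τ (pCentral p D.pm (D.v (Sum.inl i))) = algebraMap K _ (τ i) := by
    intro i
    refine LinearMap.ext fun f => ?_
    obtain ⟨u, rfl⟩ := D.specialize_surjective τ f
    rw [rep_specialize, hcomm, ← baseHom_X, specialize_mul, baseEval_X]
    rfl
  have hr : ∀ h, D.rep τ (pCentral p D.pm (D.v (Sum.inr h))) = 0 := by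
    intro h
    refine LinearMap.ext fun f => ?_
    obtain ⟨u, rfl⟩ := D.specialize_surjective τ f
    have h1 : pCentral p D.pm (D.v (Sum.inr h)) =
        D.baseHom (1 ⊗ₜ (UniversalEnvelopingAlgebra.ι K (D.w h) ^ p -
          UniversalEnvelopingAlgebra.ι K ⟨D.pm (D.w h), D.pm_mem _ (D.w h).2⟩)) := by
      rw [baseHom_tmul, map_one, one_mul, map_sub, map_pow, subHom_ι, subHom_ι, pCentral, ← D.w_eq]
    have h2 : (1 ⊗ₜ (UniversalEnvelopingAlgebra.ι K (D.w h) ^ p -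
          UniversalEnvelopingAlgebra.ι K ⟨D.pm (D.w h), D.pm_mem _ (D.w h).2⟩) : D.Base) =
        (1 ⊗ₜ UniversalEnvelopingAlgebra.ι K (D.w h)) ^ p -
          1 ⊗ₜ UniversalEnvelopingAlgebra.ι K ⟨D.pm (D.w h), D.pm_mem _ (D.w h).2⟩ := by
      rw [Algebra.TensorProduct.tmul_pow, one_pow, TensorProduct.tmul_sub]
    rw [rep_specialize, hcomm, h1, specialize_mul, h2, map_sub, map_pow, baseEval_ι, baseEval_ι,
      D.act_pm, sub_self, zero_smul]
    rfl
  rw [hx, map_sum, Fintype.sum_sum_type]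
  have hsmul : ∀ (c : K) (u : U), D.rep τ (c • u) = c • D.rep τ u := fun c u =>
    map_smul (D.rep τ) c u
  simp only [hsmul, hl, hr, smul_zero, Finset.sum_const_zero, add_zero]
  simp only [hchi, map_sum, map_mul, Algebra.smul_def]

/-- The kernel of `specialize` is contained in every left ideal `I` that contains the relations:
modulo `I`, the coordinates in `Base` can be replaced by their values under `baseEval`. -/
lemma mem_of_specialize_eq_zero (τ : J → K) (I : Submodule U U)
    (hsub : ∀ x : D.sub,
      UniversalEnvelopingAlgebra.ι K (x : L) - algebraMap K U (D.act x) ∈ I)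
    (hcen : ∀ i, pCentral p D.pm (D.v (Sum.inl i)) - algebraMap K U (τ i) ∈ I)
    {u : U} (hu : D.specialize τ u = 0) : u ∈ I := by
  have hmul : ∀ w w' : D.Base, D.baseHom w - algebraMap K U (D.baseEval τ w) ∈ I →
      D.baseHom w' - algebraMap K U (D.baseEval τ w') ∈ I →
      D.baseHom (w * w') - algebraMap K U (D.baseEval τ (w * w')) ∈ I := by
    intro w w' h h'
    have : D.baseHom (w * w') - algebraMap K U (D.baseEval τ (w * w')) =
        D.baseHom w * (D.baseHom w' - algebraMap K U (D.baseEval τ w')) +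
          algebraMap K U (D.baseEval τ w') * (D.baseHom w - algebraMap K U (D.baseEval τ w)) := by
      rw [map_mul, map_mul, mul_comm (D.baseEval τ w), map_mul (algebraMap K U), mul_sub, mul_sub,
        ← Algebra.commutes (D.baseEval τ w') (D.baseHom w)]
      abel
    rw [this]
    exact add_mem (I.smul_mem _ h') (I.smul_mem _ h)
  have hadd : ∀ w w' : D.Base, D.baseHom w - algebraMap K U (D.baseEval τ w) ∈ I →
      D.baseHom w' - algebraMap K U (D.baseEval τ w') ∈ I →
      D.baseHom (w + w') - algebraMap K U (D.baseEval τ (w + w')) ∈ I := by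
    intro w w' h h'
    rw [map_add, map_add, map_add, add_sub_add_comm]
    exact add_mem h h'
  have halg : ∀ r : K, D.baseHom (algebraMap K _ r) -
      algebraMap K U (D.baseEval τ (algebraMap K _ r)) ∈ I := by
    intro r
    rw [AlgHom.commutes, AlgHom.commutes, Algebra.algebraMap_self, RingHom.id_apply, sub_self]
    exact I.zero_mem
  have hbase : ∀ w : D.Base, D.baseHom w - algebraMap K U (D.baseEval τ w) ∈ I := by
    intro w
    induction w using TensorProduct.induction_on with
    | zero => simp
    | add w w' h h' => exact hadd w w' h h'
    | tmul P w =>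
      rw [show (P ⊗ₜ[K] w : D.Base) = (P ⊗ₜ 1) * (1 ⊗ₜ w) by simp]
      refine hmul _ _ ?_ ?_
      · induction P using MvPolynomial.induction_on with
        | C r => exact halg r
        | add P Q hP hQ =>
          rw [TensorProduct.add_tmul]
          exact hadd _ _ hP hQ
        | mul_X P i hP =>
          have : ((P * MvPolynomial.X i) ⊗ₜ[K] 1 : D.Base) = (P ⊗ₜ 1) * (MvPolynomial.X i ⊗ₜ 1) := by
            simp
          rw [this]
          refine hmul _ _ hP ?_
          rw [baseHom_X, baseEval_X]
          exact hcen i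
      · have hw : w ∈ Algebra.adjoin K (Set.range (UniversalEnvelopingAlgebra.ι K :
            D.sub → UniversalEnvelopingAlgebra K D.sub)) := by
          rw [adjoin_range_ι]; trivial
        induction hw using Algebra.adjoin_induction with
        | mem w hw =>
          obtain ⟨x, rfl⟩ := hw
          rw [baseHom_ι, baseEval_ι]
          exact hsub x
        | algebraMap r =>
          have := halg r
          rwa [Algebra.TensorProduct.algebraMap_apply, ← Algebra.TensorProduct.algebraMap_apply,
            Algebra.TensorProduct.algebraMap_apply'] at this
        | add w w' _ _ h h' =>
          rw [TensorProduct.tmul_add]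
          exact hadd _ _ h h'
        | mul w w' _ _ h h' =>
          have : (1 ⊗ₜ[K] (w * w') : D.Base) = (1 ⊗ₜ w) * (1 ⊗ₜ w') := by simp
          rw [this]
          exact hmul _ _ h h'
  have h : u = ∑ a, D.truncatedProd a * (D.baseHom (D.freeEquiv.symm u a) -
      algebraMap K U (D.baseEval τ (D.freeEquiv.symm u a))) := by
    have h0 : ∀ a, D.baseEval τ (D.freeEquiv.symm u a) = 0 := fun a => congrFun hu a
    simp only [h0, map_zero, sub_zero]
    exact D.eq_sum_truncatedProd u
  rw [h]
  exact Submodule.sum_mem _ fun a _ => I.smul_mem _ (hbase _)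

end Specialization

end InductionData

end FaithfulPBW

namespace Elimination

open MvPolynomial

/-! ### Elimination theory -/

section Resultant

variable {K : Type*} [Field K] {σ : Type*}

lemma homogeneousComponent_map {R S : Type*} [CommSemiring R] [CommSemiring S] (f : R →+* S)
    (N : ℕ) (P : MvPolynomial σ R) :
    homogeneousComponent N (map f P) = map f (homogeneousComponent N P) := by
  ext d
  rw [coeff_homogeneousComponent, coeff_map, coeff_map, coeff_homogeneousComponent, apply_ite f,
    map_zero]

/-- If a homogeneous polynomial vanishes at a point, so do the homogeneous components of its
multiples. -/
lemma eval_homogeneousComponent_mul {F : MvPolynomial σ K} {e : ℕ} (hF : F.IsHomogeneous e)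
    {x : σ → K} (hx : eval x F = 0) (a : MvPolynomial σ K) (N : ℕ) :
    eval x (homogeneousComponent N (a * F)) = 0 := by
  induction a using MvPolynomial.induction_on' with
  | monomial d c =>
    have h : (monomial d c * F).IsHomogeneous (d.degree + e) :=
      (isHomogeneous_monomial c rfl).mul hF
    rw [homogeneousComponent_of_mem ((mem_homogeneousSubmodule _ _).mpr h)]
    split_ifs
    · rw [map_mul, hx, mul_zero]
    · rw [map_zero]
  | add a b ha hb => rw [add_mul, map_add, map_add, ha, hb, add_zero]

/-- The main theorem of elimination theory: the parameters for which a system of homogeneous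
equations has a nontrivial solution form a closed set. If the system has no nontrivial solution at
`τ₀` then, by the Nullstellensatz, the ideal of the system at `τ₀` contains all monomials of some
degree `N`. Then the same combinations of the equations, for other parameters, still determine these
monomials, unless a determinant vanishes. -/
theorem exists_resultant [IsAlgClosed K] [Finite σ] {J κ : Type*}
    (F : κ → MvPolynomial σ (MvPolynomial J K)) (e : κ → ℕ) (hF : ∀ k, (F k).IsHomogeneous (e k))
    (τ₀ : J → K) (h₀ : ∀ x : σ → K, (∀ k, eval x (map (eval τ₀) (F k)) = 0) → x = 0) :
    ∃ D : MvPolynomial J K, eval τ₀ D ≠ 0 ∧ ∀ τ, eval τ D ≠ 0 →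
      ∀ x : σ → K, (∀ k, eval x (map (eval τ) (F k)) = 0) → x = 0 := by
  classical
  have := Fintype.ofFinite σ
  set I : Ideal (MvPolynomial σ K) := Ideal.span (Set.range fun k => map (eval τ₀) (F k)) with hI
  have hrad : ∀ i, X i ∈ I.radical := by
    intro i
    rw [← vanishingIdeal_zeroLocus_eq_radical (K := K), mem_vanishingIdeal_iff]
    intro x hx
    rw [mem_zeroLocus_iff] at hx
    have : x = 0 := h₀ x fun k => by
      have := hx _ (Ideal.subset_span ⟨k, rfl⟩)
      rwa [aeval_eq_eval] at this
    rw [this, aeval_X, Pi.zero_apply]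
  choose r hr using hrad
  set N : ℕ := ∑ i, r i + 1 with hN
  have hmem : ∀ d : σ →₀ ℕ, d.degree = N → monomial d (1 : K) ∈ I := by
    intro d hd
    obtain ⟨i, hi⟩ : ∃ i, r i ≤ d i := by
      by_contra! hcon
      have : d.degree ≤ ∑ i, r i := by
        rw [Finsupp.degree_eq_sum]
        exact Finset.sum_le_sum fun i _ => (hcon i).le
      omega
    have hsplit : monomial d (1 : K) =
        monomial (d - Finsupp.single i (r i)) 1 * (X i : MvPolynomial σ K) ^ r i := by
      rw [X_pow_eq_monomial, monomial_mul, one_mul, tsub_add_cancel_of_le]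
      rwa [Finsupp.single_le_iff]
    rw [hsplit]
    exact I.mul_mem_left _ (hr i)
  let S := {d : σ →₀ ℕ // d ∈ (Finset.univ : Finset σ).finsuppAntidiag N}
  have hS : ∀ d : σ →₀ ℕ, d ∈ (Finset.univ : Finset σ).finsuppAntidiag N ↔ d.degree = N := by
    intro d
    rw [Finset.mem_finsuppAntidiag, Finsupp.degree_eq_sum]
    simp
  have hcomb : ∀ d : S, ∃ c : κ →₀ MvPolynomial σ K,
      (c.sum fun k a => a * map (eval τ₀) (F k)) = monomial d.1 1 := by
    intro d
    have h := hmem d.1 ((hS _).mp d.2)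
    rw [hI, Ideal.span] at h
    obtain ⟨c, hc⟩ := (Finsupp.mem_span_range_iff_exists_finsupp).mp h
    exact ⟨c, hc⟩
  choose c hc using hcomb
  -- Homogeneous components of degree `N` are taken in order to have as many equations as monomials,
  -- and hence a square matrix `A` of coefficients. It is the identity matrix at `τ₀`.
  let G : S → MvPolynomial σ (MvPolynomial J K) := fun d =>
    homogeneousComponent N ((c d).sum fun k a => map C a * F k)
  have hC : ∀ τ : J → K, (eval τ).comp (C : K →+* MvPolynomial J K) = RingHom.id K := by
    intro τ
    ext a
    simp
  have hG : ∀ (τ : J → K) (d : S), map (eval τ) (G d) =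
      homogeneousComponent N ((c d).sum fun k a => a * map (eval τ) (F k)) := by
    intro τ d
    simp only [G, ← homogeneousComponent_map, Finsupp.sum, map_sum, map_mul, map_map, hC, map_id]
  let A : Matrix S S (MvPolynomial J K) := fun d d' => coeff d'.1 (G d)
  refine ⟨A.det, ?_, ?_⟩
  · rw [RingHom.map_det]
    have : (eval τ₀).mapMatrix A = 1 := by
      ext d d'
      rw [RingHom.mapMatrix_apply, Matrix.map_apply, ← coeff_map, hG, hc,
        coeff_homogeneousComponent, if_pos ((hS _).mp d'.2), coeff_monomial, Matrix.one_apply]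
      simp only [Subtype.ext_iff, S]
    rw [this, Matrix.det_one]
    exact one_ne_zero
  · intro τ hτ x hx
    have hzero : ∀ d : S, eval x (map (eval τ) (G d)) = 0 := by
      intro d
      rw [hG, Finsupp.sum, map_sum, map_sum]
      exact Finset.sum_eq_zero fun k _ => eval_homogeneousComponent_mul ((hF k).map _) (hx k) _ _
    have hvec : ((eval τ).mapMatrix A).mulVec (fun d : S => ∏ i, x i ^ d.1 i) = 0 := by
      funext d
      rw [Pi.zero_apply, ← hzero d, eval_eq', Matrix.mulVec, dotProduct]
      have hsub : (map (eval τ) (G d)).support ⊆ (Finset.univ : Finset σ).finsuppAntidiag N := by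
        intro d' hd'
        rw [hS]
        rw [hG, MvPolynomial.mem_support_iff, coeff_homogeneousComponent] at hd'
        by_contra hne
        exact hd' (if_neg hne)
      rw [Finset.sum_subset hsub (fun d' _ hd' => by
        rw [notMem_support_iff.mp hd', zero_mul])]
      rw [← Finset.sum_coe_sort ((Finset.univ : Finset σ).finsuppAntidiag N)]
      refine Finset.sum_congr rfl fun d' _ => ?_
      rw [coeff_map]
      rfl
    have h0 := Matrix.eq_zero_of_mulVec_eq_zero (by rwa [← RingHom.map_det]) hvec
    funext i
    have hi := congrFun h0 ⟨Finsupp.single i N, (hS _).mpr (by simp)⟩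
    simp only [Pi.zero_apply] at hi
    rw [Finset.prod_eq_single i (by
      intro j _ hj
      simp [Finsupp.single_eq_of_ne hj]) (by simp)] at hi
    rw [Finsupp.single_eq_same] at hi
    exact pow_eq_zero_iff (by omega) |>.mp hi

end Resultant

/-! ### Plücker coordinates of stable subspaces -/

section Pluecker

variable {K δ : Type*} [Field K] [Fintype δ] {s : ℕ}

/-- The vectors `u` with `u ∧ ω = 0`. Here and below, `ω` is an element of an exterior power that is
given by its alternating function of coordinates. -/
def annihilator (ω : (Fin (s + 1) → δ) → K) : Submodule K (δ → K) where
  carrier := {u | ∀ I : Fin (s + 2) → δ,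
    ∑ k : Fin (s + 2), (-1) ^ (k : ℕ) * u (I k) * ω (I ∘ k.succAbove) = 0}
  add_mem' {u v} hu hv I := by
    simp only [Pi.add_apply, mul_add, add_mul, Finset.sum_add_distrib, hu I, hv I, add_zero]
  zero_mem' I := by simp
  smul_mem' c u hu I := by
    have : ∀ k : Fin (s + 2), (-1) ^ (k : ℕ) * (c • u) (I k) * ω (I ∘ k.succAbove) =
        c * ((-1) ^ (k : ℕ) * u (I k) * ω (I ∘ k.succAbove)) := fun k => by
      rw [Pi.smul_apply, smul_eq_mul]; ring
    simp only [this, ← Finset.mul_sum, hu I, mul_zero]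

/-- The contraction of `ω` with `s` coordinate functions. -/
def contraction (ω : (Fin (s + 1) → δ) → K) (I : Fin s → δ) : δ → K := fun i => ω (Fin.cons i I)

/-- `ω` is a system of Plücker coordinates of a subspace of dimension `s + 1` that is stable under
the matrices `B a`, if it is not zero. -/
structure IsStablePluecker {A : Type*} (B : A → Matrix δ δ K) (ω : (Fin (s + 1) → δ) → K) :
    Prop where
  perm : ∀ (I : Fin (s + 1) → δ) (π : Equiv.Perm (Fin (s + 1))),
    ω (I ∘ π) = ((Equiv.Perm.sign π : ℤ) : K) * ω I
  alternating : ∀ I : Fin (s + 1) → δ, ¬ Function.Injective I → ω I = 0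
  contraction_mem : ∀ I : Fin s → δ, contraction ω I ∈ annihilator ω
  stable : ∀ a (I : Fin s → δ), (B a).mulVec (contraction ω I) ∈ annihilator ω

/-- The subspace with given Plücker coordinates. -/
lemma IsStablePluecker.exists_submodule {A : Type*} {B : A → Matrix δ δ K}
    {ω : (Fin (s + 1) → δ) → K} (h : IsStablePluecker B ω) (hω : ω ≠ 0) :
    ∃ W : Submodule K (δ → K), finrank K W = s + 1 ∧ ∀ a, ∀ u ∈ W, (B a).mulVec u ∈ W := by
  obtain ⟨I, hI⟩ := Function.ne_iff.mp hω
  rw [Pi.zero_apply] at hI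
  -- a vector that annihilates `ω` is determined by its coordinates in `I`
  have hle : finrank K (annihilator ω) ≤ s + 1 := by
    let f : annihilator ω →ₗ[K] (Fin (s + 1) → K) :=
      LinearMap.funLeft K K I ∘ₗ (annihilator ω).subtype
    have hf : Function.Injective f := by
      rw [← LinearMap.ker_eq_bot, LinearMap.ker_eq_bot']
      rintro ⟨u, hu⟩ h0
      have h0' : ∀ k, u (I k) = 0 := fun k => congrFun h0 k
      ext i
      have := hu (Fin.cons i I)
      rw [Fin.sum_univ_succ] at this
      simp only [Fin.cons_succ, h0', mul_zero, zero_mul, Finset.sum_const_zero, add_zero,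
        Fin.val_zero, pow_zero, one_mul, Fin.cons_zero] at this
      have hc : (Fin.cons i I : Fin (s + 2) → δ) ∘ (0 : Fin (s + 2)).succAbove = I := by
        funext k
        simp
      rw [hc] at this
      exact (mul_eq_zero.mp this).resolve_right hI
    simpa using LinearMap.finrank_le_finrank_of_injective hf
  -- the subspace is spanned by the contractions of `ω`; the condition `contraction_mem` bounds its
  -- dimension from above, and the contractions along the faces of `I` bound it from below
  let W : Submodule K (δ → K) := Submodule.span K (Set.range (contraction ω))
  have hW : W ≤ annihilator ω := by
    rw [Submodule.span_le]
    rintro _ ⟨J, rfl⟩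
    exact h.contraction_mem J
  have hcons : ∀ k, (Fin.cons (I k) (I ∘ k.succAbove) : Fin (s + 1) → δ) =
      I ∘ (k.cycleRange).symm := by
    intro k
    funext l
    refine Fin.cases ?_ (fun l => ?_) l
    · simp
    · simp
  have hdiag : ∀ k l, contraction ω (I ∘ k.succAbove) (I l) =
      if l = k then ((Equiv.Perm.sign (k.cycleRange).symm : ℤ) : K) * ω I else 0 := by
    intro k l
    split_ifs with hkl
    · rw [hkl, contraction, hcons, h.perm]
    · rw [contraction]
      refine h.alternating _ fun hinj => ?_
      obtain ⟨j, hj⟩ := Fin.exists_succAbove_eq hkl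
      have : (0 : Fin (s + 1)) = j.succ := hinj (by simp [hj])
      exact (Fin.succ_ne_zero j) this.symm
  have hli : LinearIndependent K fun k : Fin (s + 1) => contraction ω (I ∘ k.succAbove) := by
    rw [Fintype.linearIndependent_iff]
    intro g hg k
    have := congrFun hg (I k)
    simp only [Finset.sum_apply, Pi.smul_apply, hdiag, smul_eq_mul, mul_ite, mul_zero,
      Finset.sum_ite_eq, Finset.mem_univ, if_true, Pi.zero_apply] at this
    refine (mul_eq_zero.mp this).resolve_right (mul_ne_zero ?_ hI)
    rcases Int.units_eq_one_or (Equiv.Perm.sign (k.cycleRange).symm) with hs | hs <;> simp [hs]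
  have hge : s + 1 ≤ finrank K W := by
    have h1 := finrank_span_eq_card hli
    rw [Fintype.card_fin] at h1
    rw [← h1]
    refine Submodule.finrank_mono (Submodule.span_mono ?_)
    rintro _ ⟨k, rfl⟩
    exact ⟨_, rfl⟩
  have heq : W = annihilator ω := Submodule.eq_of_le_of_finrank_le hW (hle.trans hge)
  refine ⟨W, le_antisymm (by rw [heq]; exact hle) hge, fun a u hu => ?_⟩
  have : W ≤ (annihilator ω).comap (B a).mulVecLin := by
    rw [Submodule.span_le]
    rintro _ ⟨J, rfl⟩
    exact h.stable a J
  rw [heq]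
  exact this hu

/-- The Plücker coordinates of a stable subspace. -/
lemma exists_isStablePluecker {A : Type*} {B : A → Matrix δ δ K} {W : Submodule K (δ → K)}
    (hW : finrank K W = s + 1) (hB : ∀ a, ∀ u ∈ W, (B a).mulVec u ∈ W) :
    ∃ ω : (Fin (s + 1) → δ) → K, ω ≠ 0 ∧ IsStablePluecker B ω := by
  let b : Basis (Fin (s + 1)) K W := finBasisOfFinrankEq K W hW
  let Q : Matrix δ (Fin (s + 1)) K := fun i l => (b l : δ → K) i
  have hQ : ∀ v, Q.mulVec v = ∑ l, v l • (b l : δ → K) := by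
    intro v
    funext i
    simp [Matrix.mulVec, dotProduct, Q, mul_comm]
  -- the Plücker coordinates are the maximal minors of a matrix whose columns are a basis of `W`
  let ω : (Fin (s + 1) → δ) → K := fun I => (Q.submatrix I id).det
  have hcon : ∀ I, contraction ω I ∈ W := by
    intro I
    have : contraction ω I = ∑ l : Fin (s + 1),
        ((-1) ^ (l : ℕ) * (Q.submatrix I l.succAbove).det) • (b l : δ → K) := by
      funext i
      rw [contraction, Finset.sum_apply]
      change Matrix.det _ = _
      rw [Matrix.det_succ_row_zero]
      refine Finset.sum_congr rfl fun l _ => ?_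
      have h1 : ((Q.submatrix (Fin.cons i I) id).submatrix Fin.succ l.succAbove) =
          Q.submatrix I l.succAbove := by
        ext k l'
        simp
      rw [h1, Pi.smul_apply, smul_eq_mul]
      have h2 : Q.submatrix (Fin.cons i I) id 0 l = (b l : δ → K) i := rfl
      rw [h2]
      ring
    rw [this]
    exact Submodule.sum_mem _ fun l _ => W.smul_mem _ (b l).2
  have hann : W ≤ annihilator ω := by
    intro u hu I
    -- expand a determinant with linearly dependent columns along its first column
    let P : Matrix (Fin (s + 2)) (Fin (s + 2)) K := fun k => Fin.cons (u (I k)) (fun l => Q (I k) l)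
    have hdet : P.det = 0 := by
      rw [← Matrix.exists_mulVec_eq_zero_iff]
      refine ⟨Fin.cons (-1) (b.repr ⟨u, hu⟩), fun h => ?_, ?_⟩
      · have := congrFun h 0
        simp at this
      · funext k
        have hsum := congrArg (fun w : W => (w : δ → K) (I k)) (b.sum_repr ⟨u, hu⟩)
        simp only [Submodule.coe_sum, Submodule.coe_smul, Finset.sum_apply, Pi.smul_apply,
          smul_eq_mul] at hsum
        simp only [Matrix.mulVec, dotProduct, Fin.sum_univ_succ, P, Fin.cons_zero, Fin.cons_succ, Q,
          Pi.zero_apply]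
        rw [← hsum]
        simp [Fin.sum_univ_succ, mul_comm]
    rw [← hdet, Matrix.det_succ_column_zero]
    rfl
  refine ⟨ω, ?_, ?_, ?_, fun I => hann (hcon I), fun a I => hann (hB a _ (hcon I))⟩
  -- the rows of `Q` span, so that some maximal minor does not vanish
  · obtain ⟨κ, a, ha, hspan, hli⟩ := exists_linearIndependent' K Q.row
    have htop : Submodule.span K (Set.range Q.row) = ⊤ := by
      by_contra hne
      obtain ⟨φ, hφ, hle⟩ := Submodule.exists_le_ker_of_lt_top _ (lt_top_iff_ne_top.mpr hne)
      refine hφ ?_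
      have hφ' : ∀ v, φ v = ∑ l, v l * φ (Pi.single l 1) := by
        intro v
        conv_lhs => rw [pi_eq_sum_univ' v]
        simp
      have hz : Q.mulVec (fun l => φ (Pi.single l 1)) = 0 := by
        funext i
        have := hle (Submodule.subset_span ⟨i, rfl⟩)
        rw [LinearMap.mem_ker, hφ'] at this
        exact this
      rw [hQ] at hz
      have hz' : ∑ l, φ (Pi.single l 1) • b l = 0 := by
        apply Subtype.ext
        simpa using hz
      have := Fintype.linearIndependent_iff.mp b.linearIndependent _ hz'
      ext l
      simpa using this l
    have hb : ⊤ ≤ Submodule.span K (Set.range (Q.row ∘ a)) := by rw [hspan, htop]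
    let bκ := Basis.mk hli hb
    have : Finite κ := Module.Finite.finite_basis bκ
    have := Fintype.ofFinite κ
    have hcard : Fintype.card κ = s + 1 := by
      rw [← finrank_eq_card_basis bκ]
      simp
    let eκ : Fin (s + 1) ≃ κ := (Fintype.equivFinOfCardEq hcard).symm
    intro h
    have h1 := congrFun h (a ∘ eκ)
    have h2 : IsUnit (Q.submatrix (a ∘ eκ) id) := by
      rw [← Matrix.linearIndependent_rows_iff_isUnit]
      exact hli.comp eκ eκ.injective
    rw [Matrix.isUnit_iff_isUnit_det] at h2
    exact h2.ne_zero h1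
  · intro I π
    have : Q.submatrix (I ∘ π) id = (Q.submatrix I id).submatrix π id := rfl
    change Matrix.det _ = _ * Matrix.det _
    rw [this, Matrix.det_permute]
  · intro I hI
    rw [Function.not_injective_iff] at hI
    obtain ⟨k, l, hkl, hne⟩ := hI
    refine Matrix.det_zero_of_row_eq hne ?_
    funext j
    simp [hkl]

end Pluecker

/-! ### Stable subspaces of polynomial families of matrices -/

section Family

variable {K δ J A : Type*} [Field K] [Fintype δ] {s : ℕ}

/-- The matrix `B a`, or the identity matrix for `a = none`. With it the conditions
`contraction_mem` and `stable` of `IsStablePluecker` have a common form. -/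
def withOne [DecidableEq δ] {R : Type*} [CommRing R] (B : A → Matrix δ δ R) :
    Option A → Matrix δ δ R
  | none => 1
  | some a => B a

/-- The index type of the equations for Plücker coordinates of stable subspaces. -/
abbrev PlueckerIndex (δ A : Type*) (s : ℕ) : Type _ :=
  ((Fin (s + 1) → δ) × Equiv.Perm (Fin (s + 1))) ⊕ {I : Fin (s + 1) → δ // ¬ Function.Injective I} ⊕
    (Option A × (Fin s → δ) × (Fin (s + 2) → δ))

/-- The equations for Plücker coordinates of stable subspaces, whose coefficients are polynomials in
the parameters. -/
def plueckerEquation [DecidableEq δ] (B : A → Matrix δ δ (MvPolynomial J K)) :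
    PlueckerIndex δ A s → MvPolynomial (Fin (s + 1) → δ) (MvPolynomial J K)
  | .inl (I, π) => X (I ∘ π) - C ((Equiv.Perm.sign π : ℤ) : MvPolynomial J K) * X I
  | .inr (.inl I) => X I.1
  | .inr (.inr (a, I, I')) => ∑ k : Fin (s + 2), C ((-1) ^ (k : ℕ)) *
      (∑ i, C (withOne B a (I' k) i) * X (Fin.cons i I)) * X (I' ∘ k.succAbove)

/-- The degrees of the equations. -/
def plueckerDegree : PlueckerIndex δ A s → ℕ
  | .inl _ => 1
  | .inr (.inl _) => 1
  | .inr (.inr _) => 2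

lemma plueckerEquation_isHomogeneous [DecidableEq δ] (B : A → Matrix δ δ (MvPolynomial J K))
    (k : PlueckerIndex δ A s) : (plueckerEquation B k).IsHomogeneous (plueckerDegree k) := by
  have hC : ∀ (c : MvPolynomial J K) {P : MvPolynomial (Fin (s + 1) → δ) (MvPolynomial J K)} {d : ℕ},
      P.IsHomogeneous d → (C c * P).IsHomogeneous d := fun c P d h => by
    simpa using (isHomogeneous_C _ c).mul h
  rcases k with ⟨I, π⟩ | I | ⟨a, I, I'⟩
  · exact (isHomogeneous_X _ _).sub (hC _ (isHomogeneous_X _ _))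
  · exact isHomogeneous_X _ _
  · refine IsHomogeneous.sum _ _ _ fun k _ => ?_
    exact (hC _ (IsHomogeneous.sum _ _ _ fun i _ => hC _ (isHomogeneous_X _ _))).mul
      (isHomogeneous_X _ _)

lemma plueckerEquation_iff [DecidableEq δ] (B : A → Matrix δ δ (MvPolynomial J K)) (τ : J → K)
    (ω : (Fin (s + 1) → δ) → K) :
    (∀ k, eval ω (map (eval τ) (plueckerEquation B k)) = 0) ↔
      IsStablePluecker (fun a => (B a).map (eval τ)) ω := by
  have h1 : ∀ I π, eval ω (map (eval τ) (plueckerEquation B (.inl (I, π)))) =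
      ω (I ∘ π) - ((Equiv.Perm.sign π : ℤ) : K) * ω I := by
    intro I π
    simp [plueckerEquation]
  have h2 : ∀ I, eval ω (map (eval τ) (plueckerEquation B (.inr (.inl I)))) = ω I.1 := by
    intro I
    simp [plueckerEquation]
  have h3 : ∀ a I I', eval ω (map (eval τ) (plueckerEquation B (.inr (.inr (a, I, I'))))) =
      ∑ k : Fin (s + 2), (-1) ^ (k : ℕ) *
        ((withOne B a).map (eval τ)).mulVec (contraction ω I) (I' k) * ω (I' ∘ k.succAbove) := by
    intro a I I'
    simp [plueckerEquation, Matrix.mulVec, dotProduct, contraction]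
  have hone : ((withOne B none).map (eval τ)) = (1 : Matrix δ δ K) := by
    simp [withOne]
  constructor
  · intro h
    refine ⟨fun I π => ?_, fun I hI => ?_, fun I I' => ?_, fun a I I' => ?_⟩
    · rw [← sub_eq_zero, ← h1]
      exact h _
    · have := h (.inr (.inl ⟨I, hI⟩))
      rwa [h2] at this
    · have := h (.inr (.inr (none, I, I')))
      rwa [h3, hone, Matrix.one_mulVec] at this
    · have := h (.inr (.inr (some a, I, I')))
      rwa [h3] at this
  · rintro ⟨hp, ha, hc, hs⟩ (⟨I, π⟩ | I | ⟨a, I, I'⟩)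
    · rw [h1, hp, sub_self]
    · rw [h2, ha _ I.2]
    · rw [h3]
      rcases a with _ | a
      · rw [hone, Matrix.one_mulVec]
        exact hc I I'
      · exact hs a I I'

variable [IsAlgClosed K]

/-- For a family of matrices that depend polynomially on parameters, the parameters for which there
is a stable subspace of a given dimension form a closed set, because Grassmannians are projective
varieties. -/
theorem exists_polynomial_of_not_stable (B : A → Matrix δ δ (MvPolynomial J K)) {r : ℕ}
    (hr : 1 ≤ r) (τ₀ : J → K)
    (h₀ : ¬ ∃ W : Submodule K (δ → K), finrank K W = r ∧
      ∀ a, ∀ u ∈ W, ((B a).map (eval τ₀)).mulVec u ∈ W) :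
    ∃ D : MvPolynomial J K, eval τ₀ D ≠ 0 ∧ ∀ τ, eval τ D ≠ 0 →
      ¬ ∃ W : Submodule K (δ → K), finrank K W = r ∧
        ∀ a, ∀ u ∈ W, ((B a).map (eval τ)).mulVec u ∈ W := by
  classical
  obtain ⟨s, rfl⟩ : ∃ s, r = s + 1 := ⟨r - 1, by omega⟩
  obtain ⟨D, hD₀, hD⟩ := exists_resultant (plueckerEquation (s := s) B) plueckerDegree
    (plueckerEquation_isHomogeneous B) τ₀ fun ω hω => by
      by_contra hne
      exact h₀ (((plueckerEquation_iff B τ₀ ω).mp hω).exists_submodule hne)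
  refine ⟨D, hD₀, fun τ hτ => ?_⟩
  rintro ⟨W, hW, hstab⟩
  obtain ⟨ω, hne, hω⟩ := exists_isStablePluecker hW hstab
  exact hne (hD τ hτ ω ((plueckerEquation_iff B τ ω).mpr hω))

/-- If for all parameters there is a stable subspace whose dimension lies in a finite set, then one
of these dimensions occurs for all parameters: an affine space is not a finite union of proper
closed subsets. -/
theorem exists_dimension_forall_stable (B : A → Matrix δ δ (MvPolynomial J K)) (S : Finset ℕ)
    (hS : ∀ r ∈ S, 1 ≤ r)
    (h : ∀ τ : J → K, ∃ r ∈ S, ∃ W : Submodule K (δ → K), finrank K W = r ∧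
      ∀ a, ∀ u ∈ W, ((B a).map (eval τ)).mulVec u ∈ W) :
    ∃ r ∈ S, ∀ τ : J → K, ∃ W : Submodule K (δ → K), finrank K W = r ∧
      ∀ a, ∀ u ∈ W, ((B a).map (eval τ)).mulVec u ∈ W := by
  by_contra! hcon
  have hD : ∀ r : S, ∃ D : MvPolynomial J K, D ≠ 0 ∧ ∀ τ, eval τ D ≠ 0 →
      ¬ ∃ W : Submodule K (δ → K), finrank K W = r.1 ∧
        ∀ a, ∀ u ∈ W, ((B a).map (eval τ)).mulVec u ∈ W := by
    rintro ⟨r, hr⟩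
    obtain ⟨τ₀, hτ₀⟩ := hcon r hr
    obtain ⟨D, hD₀, hD⟩ := exists_polynomial_of_not_stable B (hS r hr) τ₀ (by
      rintro ⟨W, hW, hst⟩
      obtain ⟨a, u, hu, hau⟩ := hτ₀ W hW
      exact hau (hst a u hu))
    exact ⟨D, fun h0 => hD₀ (by rw [h0, map_zero]), hD⟩
  choose D hD0 hD using hD
  have hprod : ∏ r, D r ≠ 0 := Finset.prod_ne_zero_iff.mpr fun r _ => hD0 r
  have : Infinite K := IsAlgClosed.instInfinite
  obtain ⟨τ, hτ⟩ : ∃ τ : J → K, eval τ (∏ r, D r) ≠ 0 := by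
    by_contra! hzero
    exact hprod (MvPolynomial.funext fun τ => by rw [hzero, map_zero])
  obtain ⟨r, hr, W, hW⟩ := h τ
  rw [map_prod, Finset.prod_ne_zero_iff] at hτ
  exact hD ⟨r, hr⟩ τ (hτ _ (Finset.mem_univ _)) ⟨W, hW⟩

end Family

end Elimination

/-! ### The Borel subalgebra and its character -/

/-- The image of an `R`-submodule under an equivalence that is only `K`-linear. -/
lemma exists_finrank_eq_of_linearEquiv {K R Z V : Type*} [Field K] [Ring R] [Algebra K R]
    [AddCommGroup Z] [Module K Z] [Module R Z] [IsScalarTower K R Z] [AddCommGroup V] [Module K V]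
    (e : Z ≃ₗ[K] V) (W : Submodule R Z) :
    ∃ V' : Submodule K V, finrank K V' = finrank K W ∧ ∀ f, f ∈ V' ↔ ∃ z ∈ W, e z = f :=
  ⟨(W.restrictScalars K).map (e : Z →ₗ[K] V), LinearEquiv.finrank_map_eq e _, fun _ => Iff.rfl⟩

namespace AlgGrp

open FaithfulPBW

variable {K : Type*} [Field K] {p : ℕ} [Fact p.Prime] [CharP K p] {n : ℕ}
  {G T B : Subgroup (GL (Fin n) K)} {lam : Dual K (lieAlg T)}

/-- The intersection of `Lie G` with `Lie B`, as a subalgebra of `Lie G`. -/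
def borelSubalgebra (G B : Subgroup (GL (Fin n) K)) : LieSubalgebra K (lieAlg G) :=
  (lieAlg B).comap (lieAlg G).incl

/-- The action of the Borel subalgebra on `K_lam`. -/
def borelAct (Klam : WeightModule p G T B lam) : borelSubalgebra G B →ₗ⁅K⁆ K :=
  Klam.act.comp
    { toFun := fun x => ⟨(x : lieAlg G), x.2⟩
      map_add' := fun _ _ => rfl
      map_smul' := fun _ _ => rfl
      map_lie' := rfl }

/-- The complement of `𝔟` has a basis indexed by `Fin N`, where `N` is the dimension of `𝔟^⊥`. -/
lemma exists_inductionData (Klam : WeightModule p G T B lam) :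
    ∃ D : InductionData p K (lieAlg G) (Fin (finrank K (borelPerp G B)))
        (Fin (finrank K (borelSubalgebra G B))) (Fin n),
      D.pm = pMap p G ∧
        (∀ x : lieAlg G, x ∈ D.sub ↔ (x : Matrix (Fin n) (Fin n) K) ∈ lieAlg B) ∧
        ∀ (x : D.sub) (hx : ((x : lieAlg G) : Matrix (Fin n) (Fin n) K) ∈ lieAlg B),
          D.act x = Klam.act ⟨(x : lieAlg G), hx⟩ := by
  obtain ⟨C, hC⟩ := Submodule.exists_isCompl (borelSubalgebra G B).toSubmodule
  have hperp : borelPerp G B = (borelSubalgebra G B).toSubmodule.dualAnnihilator := by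
    ext χ
    rw [Submodule.mem_dualAnnihilator]
    rfl
  have hfin : finrank K C = finrank K (borelPerp G B) := by
    have h1 := Subspace.finrank_add_finrank_dualAnnihilator_eq
      (borelSubalgebra G B).toSubmodule
    have h2 := Submodule.finrank_add_eq_of_isCompl hC
    rw [hperp]
    omega
  let w : Basis _ K (borelSubalgebra G B) := finBasis K (borelSubalgebra G B)
  let c : Basis (Fin (finrank K (borelPerp G B))) K C := finBasisOfFinrankEq K C hfin
  let v := (c.prod w).map (Submodule.prodEquivOfIsCompl C _ hC.symm)
  refine ⟨{
    ρ := (lieAlg G).incl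
    ρ_injective := Subtype.val_injective
    pm := pMap p G
    ρ_pm := fun _ => rfl
    sub := borelSubalgebra G B
    pm_mem := fun x hx => (pMap p B ⟨x, hx⟩).2
    v := v
    w := w
    w_eq := fun h => by
      simp only [v, Basis.map_apply, Basis.prod_apply, LinearMap.coe_inl, LinearMap.coe_inr,
        Sum.elim_inr, Function.comp_apply]
      rw [Submodule.coe_prodEquivOfIsCompl']
      simp
    act := borelAct Klam
    act_pm := fun x => sub_eq_zero.mp (Klam.act_pMap ⟨x, x.2⟩) },
    rfl, fun _ => Iff.rfl, fun _ _ => rfl⟩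

/-! ### Baby Verma modules as a polynomial family -/

section Comparison

variable {J H : Type*} [Fintype J] [DecidableEq J] [Finite H]
  (D : InductionData p K (lieAlg G) J H (Fin n)) (hpm : D.pm = pMap p G)
  (hsub : ∀ x : lieAlg G, x ∈ D.sub ↔ (x : Matrix (Fin n) (Fin n) K) ∈ lieAlg B)
  (Klam : WeightModule p G T B lam)
  (hact : ∀ (x : D.sub) (hx : ((x : lieAlg G) : Matrix (Fin n) (Fin n) K) ∈ lieAlg B),
    D.act x = Klam.act ⟨(x : lieAlg G), hx⟩)
  (χ : Dual K (lieAlg G)) (hχ : χ ∈ borelPerp G B)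

/-- The values of the central elements `x ^ p - x^[p]` on modules over the reduced enveloping
algebra of `χ`. -/
abbrev centralValue : J → K := fun i => χ (D.v (Sum.inl i)) ^ p

include hpm hsub hχ in
/-- The representation `D.rep` factors through the reduced enveloping algebra. -/
lemma rep_eq_of_reducedRel ⦃u w : UniversalEnvelopingAlgebra K (lieAlg G)⦄
    (h : ReducedRel p G χ u w) :
    D.rep (centralValue D χ) u = D.rep (centralValue D χ) w := by
  obtain ⟨x⟩ := h
  have h1 := D.rep_pCentral χ (fun x hx => hχ x ((hsub x).mp hx)) x
  rw [pCentral, hpm] at h1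
  rw [map_sub, h1, map_zero, AlgHom.commutes, sub_self]

/-- The representation of the reduced enveloping algebra on `K ^ (J → Fin p)`. -/
def reducedRep : ReducedEnveloping p G χ →ₐ[K] Module.End K ((J → Fin p) → K) :=
  RingQuot.liftAlgHom K ⟨D.rep (centralValue D χ), rep_eq_of_reducedRel D hpm hsub χ hχ⟩

lemma reducedRep_mk (u : UniversalEnvelopingAlgebra K (lieAlg G)) :
    reducedRep D hpm hsub χ hχ (RingQuot.mkAlgHom K (ReducedRel p G χ) u) =
      D.rep (centralValue D χ) u :=
  RingQuot.liftAlgHom_mkAlgHom_apply _ _ _ _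

/-- The orbit map of the canonical generator. It induces the isomorphism of the baby Verma module
with `K ^ (J → Fin p)`. -/
def orbitMap : ReducedEnveloping p G χ →ₗ[K] ((J → Fin p) → K) :=
  LinearMap.applyₗ (D.specialize (centralValue D χ) 1) ∘ₗ (reducedRep D hpm hsub χ hχ).toLinearMap

lemma orbitMap_mul (r u : ReducedEnveloping p G χ) :
    orbitMap D hpm hsub χ hχ (r * u) =
      reducedRep D hpm hsub χ hχ r (orbitMap D hpm hsub χ hχ u) := by
  simp [orbitMap]

lemma orbitMap_mk (u : UniversalEnvelopingAlgebra K (lieAlg G)) :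
    orbitMap D hpm hsub χ hχ (RingQuot.mkAlgHom K (ReducedRel p G χ) u) =
      D.specialize (centralValue D χ) u := by
  rw [← D.rep_one, ← reducedRep_mk D hpm hsub χ hχ]
  rfl

lemma orbitMap_surjective : Function.Surjective (orbitMap D hpm hsub χ hχ) := fun f => by
  obtain ⟨u, rfl⟩ := D.specialize_surjective (centralValue D χ) f
  exact ⟨_, orbitMap_mk D hpm hsub χ hχ u⟩

lemma mk_ι_sub (x : lieAlg G) (c : K) :
    toReduced p G χ x - algebraMap K (ReducedEnveloping p G χ) c =
      RingQuot.mkAlgHom K (ReducedRel p G χ) (UniversalEnvelopingAlgebra.ι K x -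
        algebraMap K (UniversalEnvelopingAlgebra K (lieAlg G)) c) := by
  rw [map_sub, AlgHom.commutes, toReduced]

include hsub hact in
lemma specialize_generator (x : lieAlg G) (hx : (x : Matrix (Fin n) (Fin n) K) ∈ lieAlg B) :
    D.specialize (centralValue D χ) (UniversalEnvelopingAlgebra.ι K x -
        algebraMap K (UniversalEnvelopingAlgebra K (lieAlg G)) (Klam.act ⟨x, hx⟩)) = 0 := by
  have h1 := D.specialize_ι_of_mem (centralValue D χ) 1 ⟨x, (hsub x).mpr hx⟩
  rw [one_mul, hact ⟨x, (hsub x).mpr hx⟩ hx] at h1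
  rw [map_sub, h1, Algebra.algebraMap_eq_smul_one, map_smul, sub_self]

include hact in
lemma orbitMap_eq_zero_of_mem {r : ReducedEnveloping p G χ} (hr : r ∈ vermaIdeal p G Klam χ) :
    orbitMap D hpm hsub χ hχ r = 0 := by
  refine Submodule.span_induction (p := fun r _ => orbitMap D hpm hsub χ hχ r = 0)
    ?_ ?_ ?_ ?_ hr
  · rintro _ ⟨x, hx, rfl⟩
    rw [mk_ι_sub, orbitMap_mk]
    exact specialize_generator D hsub Klam hact χ x hx
  · exact (orbitMap D hpm hsub χ hχ).map_zero
  · intro r u _ _ hr hu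
    rw [(orbitMap D hpm hsub χ hχ).map_add, hr, hu, add_zero]
  · intro r u _ hu
    rw [smul_eq_mul, orbitMap_mul, hu, LinearMap.map_zero]

include hpm hsub hact in
lemma mem_vermaIdeal_of_specialize_eq_zero {u : UniversalEnvelopingAlgebra K (lieAlg G)}
    (hu : D.specialize (centralValue D χ) u = 0) :
    RingQuot.mkAlgHom K (ReducedRel p G χ) u ∈ vermaIdeal p G Klam χ := by
  let I : Submodule (UniversalEnvelopingAlgebra K (lieAlg G))
      (UniversalEnvelopingAlgebra K (lieAlg G)) :=
    { carrier := {u | RingQuot.mkAlgHom K (ReducedRel p G χ) u ∈ vermaIdeal p G Klam χ}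
      add_mem' := fun {a b} ha hb => by
        change RingQuot.mkAlgHom K (ReducedRel p G χ) (a + b) ∈ vermaIdeal p G Klam χ
        rw [map_add]
        exact add_mem ha hb
      zero_mem' := by
        change RingQuot.mkAlgHom K (ReducedRel p G χ) 0 ∈ vermaIdeal p G Klam χ
        rw [map_zero]
        exact zero_mem _
      smul_mem' := fun c a ha => by
        change RingQuot.mkAlgHom K (ReducedRel p G χ) (c * a) ∈ vermaIdeal p G Klam χ
        rw [map_mul]
        exact Submodule.smul_mem _ _ ha }
  refine D.mem_of_specialize_eq_zero (centralValue D χ) I (fun x => ?_) (fun i => ?_) hu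
  · have hx : ((x : lieAlg G) : Matrix (Fin n) (Fin n) K) ∈ lieAlg B := (hsub x).mp x.2
    change RingQuot.mkAlgHom K (ReducedRel p G χ) _ ∈ vermaIdeal p G Klam χ
    rw [← mk_ι_sub]
    exact Submodule.subset_span ⟨x, hx, by rw [hact x hx]⟩
  · change RingQuot.mkAlgHom K (ReducedRel p G χ) _ ∈ vermaIdeal p G Klam χ
    have h := RingQuot.mkAlgHom_rel K (ReducedRel.of (p := p) (χ := χ) (D.v (Sum.inl i)))
    rw [map_zero] at h
    rw [pCentral, hpm, h]
    exact zero_mem _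

include hact in
lemma ker_orbitMap :
    (vermaIdeal p G Klam χ).restrictScalars K = LinearMap.ker (orbitMap D hpm hsub χ hχ) := by
  apply le_antisymm
  · intro r hr
    exact orbitMap_eq_zero_of_mem D hpm hsub Klam hact χ hχ hr
  · intro r hr
    obtain ⟨u, rfl⟩ := RingQuot.mkAlgHom_surjective K (ReducedRel p G χ) r
    rw [LinearMap.mem_ker, orbitMap_mk] at hr
    exact mem_vermaIdeal_of_specialize_eq_zero D hpm hsub Klam hact χ hr

/-- The baby Verma module has the same underlying vector space `K ^ (J → Fin p)` for all `χ`. -/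
def babyVermaEquiv : BabyVerma p G Klam χ ≃ₗ[K] ((J → Fin p) → K) :=
  (Submodule.Quotient.restrictScalarsEquiv K (vermaIdeal p G Klam χ)).symm ≪≫ₗ
    Submodule.quotEquivOfEq _ _ (ker_orbitMap D hpm hsub Klam hact χ hχ) ≪≫ₗ
    (orbitMap D hpm hsub χ hχ).quotKerEquivOfSurjective (orbitMap_surjective D hpm hsub χ hχ)

lemma babyVermaEquiv_mk (r : ReducedEnveloping p G χ) :
    babyVermaEquiv D hpm hsub Klam hact χ hχ (Submodule.Quotient.mk r) =
      orbitMap D hpm hsub χ hχ r := rfl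

lemma babyVermaEquiv_smul (r : ReducedEnveloping p G χ) (z : BabyVerma p G Klam χ) :
    babyVermaEquiv D hpm hsub Klam hact χ hχ (r • z) =
      reducedRep D hpm hsub χ hχ r (babyVermaEquiv D hpm hsub Klam hact χ hχ z) := by
  obtain ⟨u, rfl⟩ := Submodule.Quotient.mk_surjective _ z
  rw [← Submodule.Quotient.mk_smul, babyVermaEquiv_mk, babyVermaEquiv_mk, smul_eq_mul,
    orbitMap_mul]

include hpm hsub hact hχ in
/-- Submodules of the baby Verma module give subspaces of `K ^ (J → Fin p)` that are stable under
the action matrices. -/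
lemma exists_stable_of_submodule (W : Submodule (ReducedEnveloping p G χ) (BabyVerma p G Klam χ)) :
    ∃ V : Submodule K ((J → Fin p) → K), finrank K V = finrank K W ∧ ∀ x, ∀ f ∈ V,
      ((D.actionMatrix x).map (MvPolynomial.eval (centralValue D χ))).mulVec f ∈ V := by
  let e := babyVermaEquiv D hpm hsub Klam hact χ hχ
  obtain ⟨V, hV, hmem⟩ := exists_finrank_eq_of_linearEquiv e W
  refine ⟨V, hV, fun x f hf => ?_⟩
  rw [hmem] at hf ⊢
  obtain ⟨z, hz, rfl⟩ := hf
  refine ⟨toReduced p G χ x • z, W.smul_mem _ hz, ?_⟩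
  change babyVermaEquiv D hpm hsub Klam hact χ hχ _ = _
  rw [babyVermaEquiv_smul, toReduced, reducedRep_mk, D.rep_ι]

include hpm hsub hact hχ in
/-- Subspaces that are stable under the action matrices give submodules of the baby Verma module. -/
lemma exists_submodule_of_stable {V : Submodule K ((J → Fin p) → K)}
    (hV : ∀ x, ∀ f ∈ V,
      ((D.actionMatrix x).map (MvPolynomial.eval (centralValue D χ))).mulVec f ∈ V) :
    ∃ W : Submodule (ReducedEnveloping p G χ) (BabyVerma p G Klam χ),
      finrank K W = finrank K V := by
  let e := babyVermaEquiv D hpm hsub Klam hact χ hχ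
  have hstab : ∀ (u : UniversalEnvelopingAlgebra K (lieAlg G)), ∀ f ∈ V,
      D.rep (centralValue D χ) u f ∈ V := by
    intro u
    have hu : u ∈ Algebra.adjoin K (Set.range
        (UniversalEnvelopingAlgebra.ι K : lieAlg G → UniversalEnvelopingAlgebra K (lieAlg G))) := by
      rw [adjoin_range_ι]; trivial
    induction hu using Algebra.adjoin_induction with
    | mem u hu =>
      obtain ⟨x, rfl⟩ := hu
      intro f hf
      rw [D.rep_ι]
      exact hV x f hf
    | algebraMap r =>
      intro f hf
      rw [AlgHom.commutes]
      exact V.smul_mem r hf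
    | add u w _ _ hu hw =>
      intro f hf
      rw [map_add]
      exact add_mem (hu f hf) (hw f hf)
    | mul u w _ _ hu hw =>
      intro f hf
      rw [map_mul]
      exact hu _ (hw f hf)
  let W : Submodule (ReducedEnveloping p G χ) (BabyVerma p G Klam χ) :=
    { carrier := {z | e z ∈ V}
      add_mem' := fun {a b} ha hb => by
        change e (a + b) ∈ V
        rw [map_add]
        exact add_mem ha hb
      zero_mem' := by
        change e 0 ∈ V
        rw [map_zero]
        exact zero_mem _
      smul_mem' := fun r z hz => by
        obtain ⟨u, rfl⟩ := RingQuot.mkAlgHom_surjective K (ReducedRel p G χ) r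
        change e (_ • z) ∈ V
        rw [babyVermaEquiv_smul, reducedRep_mk]
        exact hstab u _ hz }
  have hW : W.restrictScalars K = V.comap (e : BabyVerma p G Klam χ →ₗ[K] _) := rfl
  refine ⟨W, ?_⟩
  change finrank K (W.restrictScalars K) = _
  rw [hW]
  exact LinearEquiv.finrank_eq (e.ofSubmodule' V)

include hpm hsub hact hχ in
/-- A baby Verma module that is not irreducible has a submodule of a dimension strictly between zero
and its own. -/
lemma exists_submodule_finrank_lt
    (hns : ¬ IsSimpleModule (ReducedEnveloping p G χ) (BabyVerma p G Klam χ)) :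
    ∃ W : Submodule (ReducedEnveloping p G χ) (BabyVerma p G Klam χ),
      1 ≤ finrank K W ∧ finrank K W < p ^ Fintype.card J := by
  let e := babyVermaEquiv D hpm hsub Klam hact χ hχ
  have hdim : finrank K (BabyVerma p G Klam χ) = p ^ Fintype.card J := by
    rw [e.finrank_eq]
    simp
  have hfin : FiniteDimensional K (BabyVerma p G Klam χ) := e.symm.finiteDimensional
  have hnt : Nontrivial (BabyVerma p G Klam χ) := by
    apply nontrivial_of_finrank_pos (R := K)
    rw [hdim]
    exact pow_pos (Fact.out : p.Prime).pos _
  obtain ⟨W, hbot, htop⟩ : ∃ W : Submodule (ReducedEnveloping p G χ) (BabyVerma p G Klam χ),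
      W ≠ ⊥ ∧ W ≠ ⊤ := by
    by_contra! hcon
    refine hns ((isSimpleModule_iff _ _).mpr ⟨fun W => ?_⟩)
    by_cases h : W = ⊥
    · exact Or.inl h
    · exact Or.inr (hcon W h)
  refine ⟨W, ?_, ?_⟩
  · rw [Nat.one_le_iff_ne_zero]
    change finrank K (W.restrictScalars K) ≠ 0
    rw [Ne, Submodule.finrank_eq_zero, Submodule.restrictScalars_eq_bot_iff]
    exact hbot
  · rw [← hdim]
    change finrank K (W.restrictScalars K) < _
    refine Submodule.finrank_lt fun h => htop ?_
    rwa [Submodule.restrictScalars_eq_top_iff] at h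

omit [CharP K p] [Fintype J] [DecidableEq J] in
include hsub in
/-- The central values fill the affine space, because `K` contains all `p`-th roots. -/
lemma exists_centralValue_eq [IsAlgClosed K] (τ : J → K) :
    ∃ χ ∈ borelPerp G B, centralValue D χ = τ := by
  have hp := (Fact.out : p.Prime)
  have := Fintype.ofFinite H
  choose c hc using fun i => IsAlgClosed.exists_pow_nat_eq (τ i) hp.pos
  refine ⟨D.v.constr K (Sum.elim c 0), fun x hx => ?_, ?_⟩
  · have hx' : x ∈ D.sub := (hsub x).mpr hx
    have h := congrArg (fun y : D.sub => (y : lieAlg G)) (D.w.sum_repr ⟨x, hx'⟩)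
    simp only [AddSubmonoidClass.coe_finsetSum, SetLike.val_smul, D.w_eq] at h
    rw [← h, map_sum]
    refine Finset.sum_eq_zero fun i _ => ?_
    rw [map_smul, Basis.constr_basis]
    simp
  · funext i
    simp only [centralValue, Basis.constr_basis, Sum.elim_inl, hc]

end Comparison

end AlgGrp

end

theorem proposition4p7 {K : Type*} [Field K] [IsAlgClosed K] (p : ℕ) [Fact p.Prime] [CharP K p]
    {n : ℕ} (G T B : Subgroup (GL (Fin n) K))
    (hG : AlgGrp.IsConnectedReductive G) (hT : AlgGrp.IsMaximalTorus G T)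
    (hB : AlgGrp.IsBorel G B) (hTB : T ≤ B)
    (lam : Module.Dual K (AlgGrp.lieAlg T)) (hlam : lam ∈ AlgGrp.Lambda0 p T)
    (Klam : AlgGrp.WeightModule p G T B lam)
    (hred : ¬ ∃ μ ∈ AlgGrp.borelPerp G B,
      IsSimpleModule (AlgGrp.ReducedEnveloping p G μ) (AlgGrp.BabyVerma p G Klam μ)) :
    ∃ s : ℕ, 1 ≤ s ∧ s ≤ p ^ Module.finrank K (AlgGrp.borelPerp G B) - 1 ∧
      ∀ χ ∈ AlgGrp.borelPerp G B,
        ∃ W : Submodule (AlgGrp.ReducedEnveloping p G χ) (AlgGrp.BabyVerma p G Klam χ),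
          Module.finrank K W = s := by
  obtain ⟨D, hpm, hsub, hact⟩ := AlgGrp.exists_inductionData Klam
  obtain ⟨s, hs, hstable⟩ := Elimination.exists_dimension_forall_stable D.actionMatrix
    (Finset.Icc 1 (p ^ Module.finrank K (AlgGrp.borelPerp G B) - 1))
    (fun r hr => (Finset.mem_Icc.mp hr).1) (fun τ => by
      obtain ⟨χ, hχ, rfl⟩ := AlgGrp.exists_centralValue_eq D hsub τ
      obtain ⟨W, h1, h2⟩ := AlgGrp.exists_submodule_finrank_lt D hpm hsub Klam hact χ hχ
        fun h => hred ⟨χ, hχ, h⟩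
      rw [Fintype.card_fin] at h2
      obtain ⟨V, hV, hst⟩ := AlgGrp.exists_stable_of_submodule D hpm hsub Klam hact χ hχ W
      exact ⟨_, Finset.mem_Icc.mpr ⟨h1, by omega⟩, V, hV, hst⟩)
  obtain ⟨h1, h2⟩ := Finset.mem_Icc.mp hs
  refine ⟨s, h1, h2, fun χ hχ => ?_⟩
  obtain ⟨V, hV, hst⟩ := hstable (AlgGrp.centralValue D χ)
  obtain ⟨W, hW⟩ := AlgGrp.exists_submodule_of_stable D hpm hsub Klam hact χ hχ hst
  exact ⟨W, hW.trans hV⟩
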